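/- Let $Y$ be a real or complex Banach space, $0<h<\infty$, and let $B$ be the generator of a $C_0$-semigroup $S$ on $Y$. Let $X=C([-h,0];Y)$ with the supremum norm, let $F:X\to Y$ be continuous and let $\phi\in X$. For $x\in C([-h,\infty),Y)$ and $t\ge 0$ let $x_t\in X$ be given by $x_t(\theta)=x(t+\theta)$. A *mild solution* of $\dot x(t)=Bx(t)+F(x_t)$ $(t\ge 0)$, $x_0=\phi$, is a function $x\in C([-h,\infty),Y)$ with $x_0=\phi$ and $$x(t)=S(t)\phi(0)+\int_0^t S(t-\tau)F(x_\tau)\,d\tau,\qquad t\ge 0.$$ Let $T_0$ be the shift semigroup on $X$: $(T_0(t)\phi)(\theta)=\phi(t+\theta)$ if $-h\le t+\theta\le 0$ and $(T_0(t)\phi)(\theta)=S(t+\theta)\phi(0)$ if $t+\theta\ge 0$. For a $C_0$-semigroup $T$ on a Banach space $E$ let $E^\odot\subseteq E^*$ be the subspace of those $f$ for which $t\mapsto T^*(t)f$ is norm continuous, $T^\odot(t)$ the restriction of $T^*(t)$ to $E^\odot$, $T^{\odot*}(t)$ the adjoint of $T^\odot(t)$ on $E^{\odot*}=(E^\odot)^*$,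 and $j:E\to E^{\odot*}$ the canonical map $\langle f,jv\rangle=\langle v,f\rangle$. Take $X^\odot$ with respect to $T_0$ and $Y^\odot$ with respect to $S$. Each $f\in X^\odot$ has the form $$\langle\phi,f\rangle=\langle\phi(0),y^\odot\rangle+\int_0^h\langle\phi(-\theta),g(\theta)\rangle\,d\theta\qquad(\phi\in X)$$ with $y^\odot\in Y^\odot$ unique and $g\in L^1([0,h],Y^*)$; put $\delta f=y^\odot$, which defines a bounded linear operator $\delta:X^\odot\to Y^\odot$, and let $\ell=\delta^*j_Y:Y\to X^{\odot*}$, where $j_Y:Y\to Y^{\odot*}$ is the canonical map. Let $G=\ell\circ F:X\to X^{\odot*}$. A *solution* of $$u(t)=T_0(t)\phi+j^{-1}\int_0^t T_0^{\odot*}(t-\tau)G(u(\tau))\,d\tau,\qquad t\ge 0,\tag{$*$}$$ is a continuous function $u:[0,\infty)\to X$ such that for every $t\ge0$ the weak$^*$ integral lies in the range of $j$ and the equality holds. 1. If $x$ is a mild solution, then $u(t)=x_t$, $t\ge 0$, defines a solution of $(*)$. 2. If $u$ is a solution of $(*)$, then the function $x:[-h,\infty)\to Y$ given by $x(t)=\phi(t)$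 for $-h\le t\le 0$ and $x(t)=u(t)(0)$ for $t\ge 0$ is well defined and is a mild solution. Moreover, $x\mapsto(t\mapsto x_t)$ is a bijection from the set of mild solutions onto the set of solutions of $(*)$. -/

import Mathlib

set_option maxSynthPendingDepth 3

open scoped NNReal Topology
open Set Filter MeasureTheory

namespace AbstractDDE

noncomputable section

/-- A strongly continuous (`C₀`) semigroup of bounded linear operators on a normed space `E`. -/
structure C0Semigroup (𝕜 E : Type*) [RCLike 𝕜] [NormedAddCommGroup E] [NormedSpace 𝕜 E] where
  /-- the operators of the semigroup -/
  op : ℝ≥0 → E →L[𝕜] E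
  op_zero : op 0 = ContinuousLinearMap.id 𝕜 E
  op_add : ∀ s t : ℝ≥0, op (s + t) = (op s).comp (op t)
  continuous_orbit : ∀ v : E, Continuous fun t : ℝ≥0 => op t v

namespace C0Semigroup

variable {𝕜 E : Type*} [RCLike 𝕜] [NormedAddCommGroup E] [NormedSpace 𝕜 E]

/-- `B`, a linear operator with domain `B.domain ⊆ E`, is the (infinitesimal) generator of the
semigroup `T`: its graph consists of the pairs `(v, w)` with `t⁻¹ (T(t) v - v) → w` as `t ↓ 0`. -/
def IsGenerator (T : C0Semigroup 𝕜 E) (B : E →ₗ.[𝕜] E) : Prop :=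
  ∀ v w : E, (v, w) ∈ B.graph ↔
    Tendsto (fun t : ℝ≥0 => (((t : ℝ) : 𝕜))⁻¹ • (T.op t v - v)) (𝓝[>] 0) (𝓝 w)

/-- The adjoint semigroup `T*(t) : E* → E*`, `T*(t) f = f ∘ T(t)`. -/
def adjoint (T : C0Semigroup 𝕜 E) (t : ℝ≥0) : StrongDual 𝕜 E →L[𝕜] StrongDual 𝕜 E :=
  ContinuousLinearMap.precomp 𝕜 (T.op t)

theorem adjoint_apply (T : C0Semigroup 𝕜 E) (t : ℝ≥0) (f : StrongDual 𝕜 E) (v : E) :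
    T.adjoint t f v = f (T.op t v) := rfl

theorem adjoint_add (T : C0Semigroup 𝕜 E) (s t : ℝ≥0) (f : StrongDual 𝕜 E) :
    T.adjoint (s + t) f = T.adjoint s (T.adjoint t f) := by
  ext v
  simp only [adjoint_apply]
  rw [add_comm, T.op_add]; rfl

/-- The sun dual `E⊙` of `E` with respect to `T`: the subspace of `E*` of those `f` for which
`t ↦ T*(t) f` is norm continuous. -/
def sunDual (T : C0Semigroup 𝕜 E) : Submodule 𝕜 (StrongDual 𝕜 E) where
  carrier := {f | Continuous fun t : ℝ≥0 => T.adjoint t f}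
  add_mem' {f g} hf hg := by
    simp only [mem_ofPred_eq, map_add] at *
    exact hf.add hg
  zero_mem' := by simp only [mem_ofPred_eq, map_zero]; exact continuous_const
  smul_mem' c f hf := by
    simp only [mem_ofPred_eq, map_smul] at *
    exact hf.const_smul c

theorem mem_sunDual (T : C0Semigroup 𝕜 E) (f : StrongDual 𝕜 E) :
    f ∈ T.sunDual ↔ Continuous fun t : ℝ≥0 => T.adjoint t f := Iff.rfl

theorem adjoint_mem_sunDual (T : C0Semigroup 𝕜 E) (t : ℝ≥0) {f : StrongDual 𝕜 E}
    (hf : f ∈ T.sunDual) : T.adjoint t f ∈ T.sunDual := by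
  rw [mem_sunDual] at *
  simp only [← adjoint_add]
  exact hf.comp (continuous_id.add continuous_const)

/-- The semigroup `T⊙` on `E⊙`: the restriction of `T*` to the invariant subspace `E⊙`. -/
def sun (T : C0Semigroup 𝕜 E) : C0Semigroup 𝕜 T.sunDual where
  op t := ((T.adjoint t).comp T.sunDual.subtypeL).codRestrict T.sunDual
    fun f => T.adjoint_mem_sunDual t f.2
  op_zero := by
    ext f v
    change (f : StrongDual 𝕜 E) (T.op 0 v) = (f : StrongDual 𝕜 E) v
    rw [T.op_zero]; rfl
  op_add s t := by
    ext f v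
    exact congrArg (fun g : StrongDual 𝕜 E => g v) (T.adjoint_add s t f)
  continuous_orbit f := Continuous.subtype_mk f.2 _

theorem sun_apply (T : C0Semigroup 𝕜 E) (t : ℝ≥0) (f : T.sunDual) (v : E) :
    (T.sun.op t f : StrongDual 𝕜 E) v = (f : StrongDual 𝕜 E) (T.op t v) := rfl

/-- The semigroup `T⊙*` on the sun-star dual `E⊙*` (the dual space of `E⊙`): the adjoint of `T⊙`. -/
def sunStar (T : C0Semigroup 𝕜 E) (t : ℝ≥0) : StrongDual 𝕜 T.sunDual →L[𝕜] StrongDual 𝕜 T.sunDual :=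
  T.sun.adjoint t

/-- The canonical map `j : E → E⊙*`, `⟨f, j v⟩ = ⟨v, f⟩` for `f ∈ E⊙`. -/
def sunEmbedding (T : C0Semigroup 𝕜 E) : E →L[𝕜] StrongDual 𝕜 T.sunDual :=
  T.sunDual.subtypeL.flip

theorem sunEmbedding_apply (T : C0Semigroup 𝕜 E) (v : E) (f : T.sunDual) :
    T.sunEmbedding v f = (f : StrongDual 𝕜 E) v := rfl

theorem exists_norm_op_le [CompleteSpace E] (T : C0Semigroup 𝕜 E) (a : ℝ≥0) :
    ∃ M : ℝ, 0 ≤ M ∧ ∀ t ≤ a, ‖T.op t‖ ≤ M := by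
  obtain ⟨C, hC⟩ := banach_steinhaus (g := fun t : Icc (0 : ℝ≥0) a => T.op t) (by
    intro v
    obtain ⟨C, hC⟩ := isCompact_Icc.exists_bound_of_continuousOn
      (s := Icc (0 : ℝ≥0) a) (T.continuous_orbit v).continuousOn
    exact ⟨C, fun t => hC t t.2⟩)
  exact ⟨C, (norm_nonneg _).trans (hC ⟨0, by simp⟩), fun t ht => hC ⟨t, by simp, ht⟩⟩

theorem mem_sunDual_of_tendsto [CompleteSpace E] (T : C0Semigroup 𝕜 E) {f : StrongDual 𝕜 E}
    (hf : Tendsto (fun t : ℝ≥0 => ‖T.adjoint t f - f‖) (𝓝 0) (𝓝 0)) : f ∈ T.sunDual := by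
  rw [mem_sunDual, continuous_iff_continuousAt]
  intro t₀
  obtain ⟨M, hM0, hM⟩ := T.exists_norm_op_le (t₀ + 1)
  have hle : ∀ s t : ℝ≥0, s ≤ t → t ≤ t₀ + 1 →
      ‖T.adjoint t f - T.adjoint s f‖ ≤ M * ‖T.adjoint (t - s) f - f‖ := by
    intro s t hst ht
    refine ContinuousLinearMap.opNorm_le_bound _ (by positivity) fun v => ?_
    have h1 : T.adjoint t f = T.adjoint s (T.adjoint (t - s) f) := by
      rw [← adjoint_add, add_tsub_cancel_of_le hst]
    have h2 : (T.adjoint t f - T.adjoint s f) v = (T.adjoint (t - s) f - f) (T.op s v) := by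
      rw [h1]; rfl
    rw [h2]
    refine (ContinuousLinearMap.le_opNorm _ _).trans ?_
    have := (T.op s).le_of_opNorm_le (hM s (hst.trans ht)) v
    calc _ ≤ ‖T.adjoint (t - s) f - f‖ * (M * ‖v‖) := by gcongr
      _ = _ := by ring
  rw [ContinuousAt, tendsto_iff_norm_sub_tendsto_zero]
  have hc1 : Tendsto (fun t : ℝ≥0 => (t - t₀) + (t₀ - t)) (𝓝 t₀) (𝓝 0) := by
    have : Continuous fun t : ℝ≥0 => (t - t₀) + (t₀ - t) := by fun_prop
    simpa using this.tendsto t₀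
  have hlim : Tendsto (fun t : ℝ≥0 => M * ‖T.adjoint ((t - t₀) + (t₀ - t)) f - f‖)
      (𝓝 t₀) (𝓝 0) := by
    simpa using (hf.comp hc1).const_mul M
  refine squeeze_zero' (Eventually.of_forall fun _ => norm_nonneg _) ?_ hlim
  filter_upwards [Iic_mem_nhds (show t₀ < t₀ + 1 by simp)] with t ht
  rcases le_total t t₀ with h | h
  · rw [norm_sub_rev]
    simpa [tsub_eq_zero_of_le h] using hle t t₀ h (by simp)
  · simpa [tsub_eq_zero_of_le h] using hle t₀ t h ht

end C0Semigroup

/-- `z` is the weak* integral over `[a,b]` of the function `f` with values in the dual of `W`: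
`⟨w, z⟩ = ∫ ⟨w, f τ⟩ dτ` for all `w ∈ W`. -/
def HasWeakStarIntegral {𝕜 W : Type*} [RCLike 𝕜] [NormedAddCommGroup W] [NormedSpace 𝕜 W]
    (f : ℝ → StrongDual 𝕜 W) (a b : ℝ) (z : StrongDual 𝕜 W) : Prop :=
  ∀ w : W, IntervalIntegrable (fun τ => f τ w) volume a b ∧ z w = ∫ τ in a..b, f τ w

/-- `u : [0,∞) → E` is a solution of the abstract integral equation
`u(t) = T(t) φ + j⁻¹ ∫₀ᵗ T⊙*(t - τ) G(u(τ)) dτ`, `t ≥ 0`: it is continuous and, for every `t ≥ 0`,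
the weak* integral is equal to `j ψ` for some `ψ ∈ E` and `u(t) = T(t) φ + ψ`. -/
def IsAIESolution {𝕜 E : Type*} [RCLike 𝕜] [NormedAddCommGroup E] [NormedSpace 𝕜 E]
    (T : C0Semigroup 𝕜 E) (G : E → StrongDual 𝕜 T.sunDual) (φ : E) (u : ℝ≥0 → E) : Prop :=
  Continuous u ∧ ∀ t : ℝ≥0, ∃ ψ : E,
    HasWeakStarIntegral (fun τ : ℝ => T.sunStar (t - τ.toNNReal) (G (u τ.toNNReal))) 0 t
      (T.sunEmbedding ψ) ∧
    u t = T.op t φ + ψ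

section Shift

variable {𝕜 Y : Type*} [RCLike 𝕜] [NormedAddCommGroup Y] [NormedSpace 𝕜 Y]
variable {h : ℝ} [hh : Fact (0 < h)]

/-- The endpoint `0` of the interval `[-h, 0]`. -/
def zeroPt (h : ℝ) [hh : Fact (0 < h)] : Icc (-h) (0 : ℝ) := ⟨0, by simpa using hh.out.le, le_rfl⟩

theorem neg_h_le (h : ℝ) [hh : Fact (0 < h)] : -h ≤ (0 : ℝ) := (zeroPt h).2.1

/-- The function that is equal to `φ(r)` for `-h ≤ r ≤ 0` and to `S(r) φ(0)` for `r > 0`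
(its values for `r < -h` are irrelevant). -/
def shiftExt (S : C0Semigroup 𝕜 Y) (φ : C(Icc (-h) (0 : ℝ), Y)) (r : ℝ) : Y :=
  if r ≤ 0 then φ (projIcc (-h) 0 (neg_h_le h) r) else S.op r.toNNReal (φ (zeroPt h))

theorem shiftExt_of_mem (S : C0Semigroup 𝕜 Y) (φ : C(Icc (-h) (0 : ℝ), Y))
    (θ : Icc (-h) (0 : ℝ)) : shiftExt S φ θ = φ θ := by
  rw [shiftExt, if_pos θ.2.2, projIcc_val]

theorem shiftExt_coe (S : C0Semigroup 𝕜 Y) (φ : C(Icc (-h) (0 : ℝ), Y)) (t : ℝ≥0) :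
    shiftExt S φ t = S.op t (φ (zeroPt h)) := by
  rcases eq_or_ne t 0 with rfl | ht
  · rw [S.op_zero]
    exact shiftExt_of_mem S φ (zeroPt h)
  · rw [shiftExt, if_neg (by simpa [pos_iff_ne_zero] using ht), Real.toNNReal_coe]

theorem continuous_shiftExt (S : C0Semigroup 𝕜 Y) (φ : C(Icc (-h) (0 : ℝ), Y)) :
    Continuous (shiftExt S φ) := by
  refine Continuous.if_le (φ.continuous.comp continuous_projIcc)
    ((S.continuous_orbit _).comp continuous_real_toNNReal) continuous_id continuous_const ?_
  rintro r rfl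
  simp only [Real.toNNReal_zero, S.op_zero]
  exact congrArg φ (projIcc_right _)

/-- The shift semigroup on `C([-h,0]; Y)` associated with a `C₀`-semigroup `S` on `Y`:
`(T₀(t) φ)(θ) = φ(t + θ)` if `t + θ ≤ 0` and `(T₀(t) φ)(θ) = S(t + θ) φ(0)` if `t + θ ≥ 0`. -/
def shiftSemigroup [CompleteSpace Y] (h : ℝ) [hh : Fact (0 < h)] (S : C0Semigroup 𝕜 Y) :
    C0Semigroup 𝕜 C(Icc (-h) (0 : ℝ), Y) where
  op t := LinearMap.mkContinuousOfExistsBound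
    { toFun := fun φ => ⟨fun θ => shiftExt S φ (t + θ),
        (continuous_shiftExt S φ).comp (continuous_const.add continuous_subtype_val)⟩
      map_add' := fun φ ψ => by
        ext θ
        simp only [shiftExt, ContinuousMap.add_apply, ContinuousMap.coe_mk, map_add]
        split_ifs <;> rfl
      map_smul' := fun c φ => by
        ext θ
        simp only [shiftExt, ContinuousMap.smul_apply, ContinuousMap.coe_mk, map_smul,
          RingHom.id_apply]
        split_ifs <;> rfl } (by
    obtain ⟨M, hM0, hM⟩ := S.exists_norm_op_le t
    refine ⟨M + 1, fun φ => (ContinuousMap.norm_le _ (by positivity)).2 fun θ => ?_⟩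
    simp only [LinearMap.coe_mk, AddHom.coe_mk, ContinuousMap.coe_mk, shiftExt]
    split_ifs with hθ
    · refine (φ.norm_coe_le_norm _).trans ?_
      nlinarith [norm_nonneg φ]
    · refine ((S.op _).le_of_opNorm_le (hM _ ?_) _).trans ?_
      · rw [Real.toNNReal_le_iff_le_coe]
        linarith [θ.2.2]
      · have := φ.norm_coe_le_norm (zeroPt h)
        nlinarith [norm_nonneg φ])
  op_zero := by
    ext φ θ
    change shiftExt S φ ((0 : ℝ≥0) + θ) = φ θ
    rw [NNReal.coe_zero, zero_add, shiftExt_of_mem]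
  op_add s t := by
    ext φ θ
    change shiftExt S φ ((s + t : ℝ≥0) + θ) =
      shiftExt S (⟨fun θ => shiftExt S φ (t + θ), _⟩ : C(Icc (-h) (0 : ℝ), Y)) (s + θ)
    rcases le_or_gt ((s : ℝ) + θ) 0 with hs | hs
    · have hmem : (s : ℝ) + θ ∈ Icc (-h) (0 : ℝ) := ⟨by linarith [θ.2.1, s.2], hs⟩
      rw [shiftExt_of_mem S _ ⟨(s : ℝ) + θ, hmem⟩]
      simp only [ContinuousMap.coe_mk]
      congr 1
      push_cast; ring
    · obtain ⟨r, hr⟩ : ∃ r : ℝ≥0, (r : ℝ) = s + θ := ⟨⟨_, hs.le⟩, rfl⟩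
      rw [← hr, shiftExt_coe]
      have h1 : ((s + t : ℝ≥0) : ℝ) + θ = (r + t : ℝ≥0) := by push_cast; linarith
      have h2 : (t : ℝ) + (zeroPt h : ℝ) = t := by simp [zeroPt]
      simp only [ContinuousMap.coe_mk]
      rw [h1, h2, shiftExt_coe, shiftExt_coe, S.op_add]
      rfl
  continuous_orbit φ := by
    have : Continuous fun p : ℝ≥0 × Icc (-h) (0 : ℝ) => shiftExt S φ (p.1 + p.2) :=
      (continuous_shiftExt S φ).comp (by fun_prop)
    exact (ContinuousMap.curry ⟨_, this⟩).continuous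

theorem shiftSemigroup_apply [CompleteSpace Y] (S : C0Semigroup 𝕜 Y) (t : ℝ≥0)
    (φ : C(Icc (-h) (0 : ℝ), Y)) (θ : Icc (-h) (0 : ℝ)) :
    (shiftSemigroup h S).op t φ θ = shiftExt S φ (t + θ) := rfl

/-- The history `x_t ∈ C([-h,0]; Y)`, `x_t(θ) = x(t + θ)`, at time `t ≥ 0` of a function
`x ∈ C([-h,∞), Y)`. -/
def history (x : C(Ici (-h), Y)) (t : ℝ≥0) : C(Icc (-h) (0 : ℝ), Y) :=
  ⟨fun θ => x ⟨t + θ, by have := θ.2.1; have := t.2; simp only [mem_Ici]; linarith⟩,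
    x.continuous.comp (by fun_prop)⟩

/-- `x ∈ C([-h,∞), Y)` is a mild solution of `x'(t) = B x(t) + F(x_t)`, `x_0 = φ`, where `S` is the
`C₀`-semigroup generated by `B`: `x_0 = φ` and
`x(t) = S(t) φ(0) + ∫₀ᵗ S(t - τ) F(x_τ) dτ` for all `t ≥ 0` (the integrand is continuous). -/
def IsMildSolution [NormedSpace ℝ Y] (S : C0Semigroup 𝕜 Y)
    (F : C(Icc (-h) (0 : ℝ), Y) → Y) (φ : C(Icc (-h) (0 : ℝ), Y)) (x : C(Ici (-h), Y)) : Prop :=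
  history x 0 = φ ∧ ∀ t : ℝ≥0,
    x ⟨t, (neg_h_le h).trans t.2⟩ = S.op t (φ (zeroPt h)) +
      ∫ τ in (0 : ℝ)..t, S.op (t - τ.toNNReal) (F (history x τ.toNNReal))

end Shift

section SunDual

variable {𝕜 Y : Type*} [RCLike 𝕜] [NormedAddCommGroup Y] [NormedSpace 𝕜 Y]
variable {h : ℝ} [hh : Fact (0 < h)]

/-- The functional `f` on `C([-h,0]; Y)` is represented by the pair `(y, g)` with `y ∈ Y*` and
`g ∈ L¹([0,h], Y*)`: `⟨φ, f⟩ = ⟨φ(0), y⟩ + ∫₀ʰ ⟨φ(-θ), g(θ)⟩ dθ` for all `φ`. -/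
def IsRepresentedBy (f : StrongDual 𝕜 C(Icc (-h) (0 : ℝ), Y)) (y : StrongDual 𝕜 Y)
    (g : ℝ → StrongDual 𝕜 Y) : Prop :=
  IntegrableOn g (Icc 0 h) ∧ ∀ φ : C(Icc (-h) (0 : ℝ), Y),
    f φ = y (φ (zeroPt h)) + ∫ θ in (0 : ℝ)..h, g θ (φ (projIcc (-h) 0 (neg_h_le h) (-θ)))

end SunDual

section SunDual

set_option linter.unusedSectionVars false

variable {𝕜 Y : Type*} [RCLike 𝕜] [NormedAddCommGroup Y] [NormedSpace 𝕜 Y]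
variable {h : ℝ} [hh : Fact (0 < h)]

/-- The map `v ↦ k ⊗ v`, `(k ⊗ v)(θ) = k(θ) v`. -/
def tens (𝕜 Y : Type*) [RCLike 𝕜] [NormedAddCommGroup Y] [NormedSpace 𝕜 Y]
    (k : C(Icc (-h) (0 : ℝ), ℝ)) : Y →L[𝕜] C(Icc (-h) (0 : ℝ), Y) :=
  LinearMap.mkContinuous
    { toFun := fun v => ⟨fun θ => ((k θ : ℝ) : 𝕜) • v, by fun_prop⟩
      map_add' := fun v w => by ext θ; simp
      map_smul' := fun c v => by ext θ; simp [smul_smul, mul_comm] } ‖k‖ (by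
    intro v
    refine (ContinuousMap.norm_le _ (by positivity)).2 fun θ => ?_
    simp only [LinearMap.coe_mk, AddHom.coe_mk, ContinuousMap.coe_mk, norm_smul,
      RCLike.norm_ofReal]
    gcongr
    exact k.norm_coe_le_norm θ)

theorem tens_apply (k : C(Icc (-h) (0 : ℝ), ℝ)) (v : Y) (θ : Icc (-h) (0 : ℝ)) :
    tens 𝕜 Y k v θ = ((k θ : ℝ) : 𝕜) • v := rfl

theorem norm_tens_le (k : C(Icc (-h) (0 : ℝ), ℝ)) : ‖tens 𝕜 Y k‖ ≤ ‖k‖ :=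
  LinearMap.mkContinuous_norm_le _ (norm_nonneg _) _

theorem tens_sub (k l : C(Icc (-h) (0 : ℝ), ℝ)) :
    tens 𝕜 Y (k - l) = tens 𝕜 Y k - tens 𝕜 Y l := by
  ext v θ
  simp [tens_apply, sub_smul]

theorem continuous_tens : Continuous (tens 𝕜 Y : C(Icc (-h) (0 : ℝ), ℝ) → _) := by
  refine LipschitzWith.continuous (K := 1) (LipschitzWith.of_dist_le_mul fun k l => ?_)
  rw [dist_eq_norm, dist_eq_norm, ← tens_sub]
  simpa using norm_tens_le (𝕜 := 𝕜) (Y := Y) (k - l)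

/-- A peak at `0`: the function `θ ↦ max (1 + n θ) 0`. -/
def peak (h : ℝ) (n : ℕ) : C(Icc (-h) (0 : ℝ), ℝ) :=
  ⟨fun θ => max (1 + n * (θ : ℝ)) 0, by fun_prop⟩

theorem peak_zeroPt (n : ℕ) : peak h n (zeroPt h) = 1 := by simp [peak, zeroPt]

theorem norm_peak_le (n : ℕ) : ‖peak h n‖ ≤ 1 := by
  refine (ContinuousMap.norm_le _ zero_le_one).2 fun θ => ?_
  have : (n : ℝ) * (θ : ℝ) ≤ 0 := mul_nonpos_of_nonneg_of_nonpos (by positivity) θ.2.2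
  simp only [peak, ContinuousMap.coe_mk, Real.norm_eq_abs]
  rw [abs_of_nonneg (le_max_right _ _)]
  exact max_le (by linarith) zero_le_one

theorem peak_eventually {θ : ℝ} (hθ : θ < 0) (hm : θ ∈ Icc (-h) (0 : ℝ)) :
    ∀ᶠ n : ℕ in atTop, peak h n ⟨θ, hm⟩ = 0 := by
  obtain ⟨N, hN⟩ := exists_nat_gt (1 / (-θ))
  filter_upwards [eventually_ge_atTop N] with n hn
  have h1 : (1 / (-θ)) < n := hN.trans_le (by exact_mod_cast hn)
  rw [div_lt_iff₀ (by linarith)] at h1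
  simp only [peak, ContinuousMap.coe_mk]
  exact max_eq_right (by linarith)

theorem integrableOn_apply {g : ℝ → StrongDual 𝕜 Y} (hg : IntegrableOn g (Icc 0 h))
    {c : ℝ → Y} (hc : Continuous c) : IntervalIntegrable (fun θ => g θ (c θ)) volume 0 h := by
  rw [intervalIntegrable_iff_integrableOn_Icc_of_le hh.out.le]
  obtain ⟨C, hC⟩ := isCompact_Icc.exists_bound_of_continuousOn (s := Icc 0 h) hc.continuousOn
  have hm : AEStronglyMeasurable (fun θ => g θ (c θ)) (volume.restrict (Icc 0 h)) := by
    have : Continuous fun p : StrongDual 𝕜 Y × Y => p.1 p.2 :=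
      isBoundedBilinearMap_apply.continuous
    have hcm : AEStronglyMeasurable c (volume.restrict (Icc 0 h)) :=
      hc.aestronglyMeasurable
    exact this.comp_aestronglyMeasurable (hg.aestronglyMeasurable.prodMk hcm)
  refine Integrable.mono' (hg.norm.mul_const C) hm ?_
  filter_upwards [ae_restrict_mem measurableSet_Icc] with θ hθ
  exact ((g θ).le_opNorm _).trans (by gcongr; exact hC θ hθ)

theorem IsRepresentedBy.tendsto {f : StrongDual 𝕜 C(Icc (-h) (0 : ℝ), Y)} {y : StrongDual 𝕜 Y}
    {g : ℝ → StrongDual 𝕜 Y} (H : IsRepresentedBy f y g) (v : Y) :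
    Tendsto (fun n => f (tens 𝕜 Y (peak h n) v)) atTop (𝓝 (y v)) := by
  have h0 : ∀ n, f (tens 𝕜 Y (peak h n) v) = y v + ∫ θ in (0 : ℝ)..h,
      g θ (tens 𝕜 Y (peak h n) v (projIcc (-h) 0 (neg_h_le h) (-θ))) := by
    intro n
    rw [H.2, tens_apply, peak_zeroPt]
    simp
  simp only [h0]
  have hlim : Tendsto (fun n => ∫ θ in (0 : ℝ)..h,
      g θ (tens 𝕜 Y (peak h n) v (projIcc (-h) 0 (neg_h_le h) (-θ)))) atTop
      (𝓝 (∫ θ in (0 : ℝ)..h, (0 : 𝕜))) := by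
    refine intervalIntegral.tendsto_integral_filter_of_dominated_convergence
      (fun θ => ‖g θ‖ * ‖v‖) (Eventually.of_forall fun n => ?_)
      (Eventually.of_forall fun n => Eventually.of_forall fun θ _ => ?_) ?_
      (Eventually.of_forall fun θ hθ => ?_)
    · have := integrableOn_apply H.1 (c := fun θ : ℝ =>
        tens 𝕜 Y (peak h n) v (projIcc (-h) 0 (neg_h_le h) (-θ))) (by fun_prop)
      exact this.def'.aestronglyMeasurable
    · refine ((g θ).le_opNorm _).trans ?_
      gcongr
      refine (ContinuousMap.norm_coe_le_norm _ _).trans ?_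
      refine ((tens 𝕜 Y (peak h n)).le_of_opNorm_le
        ((norm_tens_le _).trans (norm_peak_le n)) v).trans ?_
      simp
    · exact ((intervalIntegrable_iff_integrableOn_Icc_of_le hh.out.le).2 H.1).norm.mul_const _
    · rw [uIoc_of_le hh.out.le] at hθ
      refine tendsto_const_nhds.congr' ?_
      have hm : -θ ∈ Icc (-h) (0 : ℝ) := ⟨by linarith [hθ.2], by linarith [hθ.1]⟩
      filter_upwards [peak_eventually (h := h) (by linarith [hθ.1] : -θ < 0) hm] with n hn
      rw [projIcc_of_mem _ hm, tens_apply, hn]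
      simp
  simpa using hlim.const_add (y v)

theorem IsRepresentedBy.norm_le {f : StrongDual 𝕜 C(Icc (-h) (0 : ℝ), Y)} {y : StrongDual 𝕜 Y}
    {g : ℝ → StrongDual 𝕜 Y} (H : IsRepresentedBy f y g) : ‖y‖ ≤ ‖f‖ := by
  refine ContinuousLinearMap.opNorm_le_bound _ (norm_nonneg _) fun v => ?_
  refine le_of_tendsto (H.tendsto v).norm (Eventually.of_forall fun n => ?_)
  refine (f.le_opNorm _).trans ?_
  gcongr
  refine ((tens 𝕜 Y (peak h n)).le_of_opNorm_le
    ((norm_tens_le _).trans (norm_peak_le n)) v).trans ?_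
  simp

theorem IsRepresentedBy.unique {f : StrongDual 𝕜 C(Icc (-h) (0 : ℝ), Y)}
    {y y' : StrongDual 𝕜 Y} {g g' : ℝ → StrongDual 𝕜 Y} (H : IsRepresentedBy f y g)
    (H' : IsRepresentedBy f y' g') : y = y' := by
  ext v
  exact tendsto_nhds_unique (H.tendsto v) (H'.tendsto v)

theorem IsRepresentedBy.add {f f' : StrongDual 𝕜 C(Icc (-h) (0 : ℝ), Y)}
    {y y' : StrongDual 𝕜 Y} {g g' : ℝ → StrongDual 𝕜 Y} (H : IsRepresentedBy f y g)
    (H' : IsRepresentedBy f' y' g') : IsRepresentedBy (f + f') (y + y') (g + g') := by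
  refine ⟨H.1.add H'.1, fun φ => ?_⟩
  have hc : Continuous fun θ : ℝ => φ (projIcc (-h) 0 (neg_h_le h) (-θ)) := by fun_prop
  simp only [add_apply, Pi.add_apply]
  rw [intervalIntegral.integral_add (integrableOn_apply H.1 hc) (integrableOn_apply H'.1 hc),
    H.2, H'.2]
  ring

theorem IsRepresentedBy.smul {f : StrongDual 𝕜 C(Icc (-h) (0 : ℝ), Y)}
    {y : StrongDual 𝕜 Y} {g : ℝ → StrongDual 𝕜 Y} (H : IsRepresentedBy f y g) (c : 𝕜) :
    IsRepresentedBy (c • f) (c • y) (c • g) := by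
  refine ⟨H.1.smul c, fun φ => ?_⟩
  simp only [smul_apply, Pi.smul_apply, smul_eq_mul]
  rw [intervalIntegral.integral_const_mul, H.2]
  ring

theorem IsRepresentedBy.sub {f f' : StrongDual 𝕜 C(Icc (-h) (0 : ℝ), Y)}
    {y y' : StrongDual 𝕜 Y} {g g' : ℝ → StrongDual 𝕜 Y} (H : IsRepresentedBy f y g)
    (H' : IsRepresentedBy f' y' g') : IsRepresentedBy (f - f') (y - y') (g - g') := by
  simpa [sub_eq_add_neg] using H.add (H'.smul (-1))

theorem exists_near_norming (g : StrongDual 𝕜 Y) {ε : ℝ} (hε : 0 < ε) :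
    ∃ v : Y, ‖v‖ ≤ 1 ∧ ‖g‖ - ε < RCLike.re (g v) := by
  by_cases hg : ‖g‖ - ε < 0
  · exact ⟨0, by simp, by simpa using hg⟩
  · obtain ⟨v, hv, hgv⟩ := ContinuousLinearMap.exists_lt_apply_of_lt_opNorm g
      (r := ‖g‖ - ε) (by linarith)
    obtain ⟨c, hc, hcv⟩ := RCLike.exists_norm_eq_mul_self (g v)
    refine ⟨c • v, by rw [norm_smul, hc, one_mul]; exact hv.le, ?_⟩
    rw [map_smul, smul_eq_mul, ← hcv, RCLike.ofReal_re]
    exact hgv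

theorem IsRepresentedBy.integral_norm_le {f : StrongDual 𝕜 C(Icc (-h) (0 : ℝ), Y)}
    {y : StrongDual 𝕜 Y} {g : ℝ → StrongDual 𝕜 Y} (H : IsRepresentedBy f y g)
    (hg : Continuous g) : ∫ θ in (0 : ℝ)..h, ‖g θ‖ ≤ 2 * ‖f‖ := by
  let : NormedSpace ℝ Y := NormedSpace.restrictScalars ℝ 𝕜 Y
  have : IsScalarTower ℝ 𝕜 Y := RestrictScalars.isScalarTower ℝ 𝕜 Y
  refine le_of_forall_pos_le_add fun ε' hε' => ?_
  obtain ⟨ε, hε, hεh⟩ : ∃ ε > 0, ε * h ≤ ε' :=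
    ⟨ε' / h, div_pos hε' hh.out, by rw [div_mul_cancel₀ _ hh.out.ne']⟩
  obtain ⟨φ, hφ⟩ := exists_continuous_forall_mem_convex_of_local_const
    (X := Icc (-h) (0 : ℝ)) (E := Y)
    (t := fun θ => {v : Y | ‖v‖ ≤ 1 ∧ ‖g (-θ)‖ - ε ≤ RCLike.re (g (-θ) v)}) (by
      intro θ v hv w hw a b ha hb hab
      refine ⟨?_, ?_⟩
      · calc ‖a • v + b • w‖ ≤ ‖a • v‖ + ‖b • w‖ := norm_add_le _ _
          _ = a * ‖v‖ + b * ‖w‖ := by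
            rw [norm_smul, norm_smul, Real.norm_of_nonneg ha, Real.norm_of_nonneg hb]
          _ ≤ a * 1 + b * 1 := by gcongr; exacts [hv.1, hw.1]
          _ = 1 := by linarith
      · have h1 := hv.2
        have h2 := hw.2
        rw [map_add, ← algebraMap_smul 𝕜 a v, ← algebraMap_smul 𝕜 b w, map_smul, map_smul]
        simp only [RCLike.algebraMap_eq_ofReal, smul_eq_mul, map_add, RCLike.re_ofReal_mul]
        calc ‖g (-θ)‖ - ε = a * (‖g (-θ)‖ - ε) + b * (‖g (-θ)‖ - ε) := by
              rw [← add_mul, hab, one_mul]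
          _ ≤ _ := by gcongr) (by
      intro θ
      obtain ⟨v, hv, hgv⟩ := exists_near_norming (g (-θ)) hε
      refine ⟨v, ?_⟩
      have hc : Continuous fun θ' : Icc (-h) (0 : ℝ) =>
          RCLike.re (g (-θ') v) - ‖g (-θ')‖ := by fun_prop
      have := hc.tendsto θ
      filter_upwards [this.eventually_const_lt (show -ε < _ by linarith)] with θ' hθ'
      exact ⟨hv, by linarith⟩)
  have hφ1 : ‖φ‖ ≤ 1 := (ContinuousMap.norm_le _ zero_le_one).2 fun θ => (hφ θ).1
  have hci : IntervalIntegrable (fun θ => g θ (φ (projIcc (-h) 0 (neg_h_le h) (-θ)))) volume 0 h :=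
    integrableOn_apply H.1 (by fun_prop)
  have hkey : (∫ θ in (0 : ℝ)..h, ‖g θ‖) - ε * h ≤ RCLike.re (∫ θ in (0 : ℝ)..h,
      g θ (φ (projIcc (-h) 0 (neg_h_le h) (-θ)))) := by
    have e1 : RCLike.re (∫ θ in (0 : ℝ)..h, g θ (φ (projIcc (-h) 0 (neg_h_le h) (-θ)))) =
        ∫ θ in (0 : ℝ)..h, RCLike.re (g θ (φ (projIcc (-h) 0 (neg_h_le h) (-θ)))) :=
      (RCLike.reCLM.intervalIntegral_comp_comm hci).symm
    have e2 : (∫ θ in (0 : ℝ)..h, ‖g θ‖) - ε * h = ∫ θ in (0 : ℝ)..h, (‖g θ‖ - ε) := by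
      rw [intervalIntegral.integral_sub (hg.norm.intervalIntegrable _ _) (by simp)]
      simp [mul_comm]
    rw [e1, e2]
    refine intervalIntegral.integral_mono_on hh.out.le
      ((hg.norm.sub continuous_const).intervalIntegrable _ _) ?_ fun θ hθ => ?_
    · rw [intervalIntegrable_iff_integrableOn_Ioc_of_le hh.out.le] at hci ⊢
      exact RCLike.reCLM.integrable_comp hci
    · have hm : -θ ∈ Icc (-h) (0 : ℝ) := ⟨by linarith [hθ.2], by linarith [hθ.1]⟩
      have := (hφ ⟨-θ, hm⟩).2
      rw [projIcc_of_mem _ hm]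
      simpa using this
  have hle : RCLike.re (∫ θ in (0 : ℝ)..h, g θ (φ (projIcc (-h) 0 (neg_h_le h) (-θ)))) ≤
      2 * ‖f‖ := by
    have e : ∫ θ in (0 : ℝ)..h, g θ (φ (projIcc (-h) 0 (neg_h_le h) (-θ))) =
        f φ - y (φ (zeroPt h)) := by rw [H.2]; ring
    rw [e]
    refine (RCLike.re_le_norm _).trans ((norm_sub_le _ _).trans ?_)
    have b1 := (f.le_opNorm φ)
    have b2 := (y.le_opNorm (φ (zeroPt h)))
    have b3 := (hφ (zeroPt h)).1
    have b4 := H.norm_le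
    nlinarith [norm_nonneg f, norm_nonneg y]
  linarith

end SunDual

section SunDual2

set_option linter.unusedSectionVars false

variable {𝕜 Y : Type*} [RCLike 𝕜] [NormedAddCommGroup Y] [NormedSpace 𝕜 Y] [CompleteSpace Y]
variable {h : ℝ} [hh : Fact (0 < h)]

/-- If a functional in the sun dual is represented by `(y, g)`, then `y ∈ Y⊙`. -/
theorem IsRepresentedBy.mem_sunDual {S : C0Semigroup 𝕜 Y}
    {f : StrongDual 𝕜 C(Icc (-h) (0 : ℝ), Y)} {y : StrongDual 𝕜 Y}
    {g : ℝ → StrongDual 𝕜 Y} (H : IsRepresentedBy f y g)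
    (hf : f ∈ (shiftSemigroup h S).sunDual) : y ∈ S.sunDual := by
  obtain ⟨M, hM0, hM⟩ := S.exists_norm_op_le 1
  have hgi : IntervalIntegrable g volume 0 h :=
    (intervalIntegrable_iff_integrableOn_Icc_of_le hh.out.le).2 H.1
  have key : ∀ t : ℝ≥0, t ≤ 1 → ‖S.adjoint t y - y‖ ≤
      ‖(shiftSemigroup h S).adjoint t f - f‖ +
        M * ∫ θ in (0 : ℝ)..h, (if θ < t then ‖g θ‖ else 0) := by
    intro t ht
    have hind : IntervalIntegrable (fun θ => if θ < t then ‖g θ‖ else 0) volume 0 h := by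
      rw [intervalIntegrable_iff_integrableOn_Ioc_of_le hh.out.le] at hgi ⊢
      exact hgi.norm.indicator (s := Iio (t : ℝ)) measurableSet_Iio
    have hI0 : 0 ≤ ∫ θ in (0 : ℝ)..h, (if θ < t then ‖g θ‖ else 0) :=
      intervalIntegral.integral_nonneg hh.out.le fun θ _ => by split_ifs <;> positivity
    refine ContinuousLinearMap.opNorm_le_bound _ (by positivity) fun v => ?_
    set p : ℕ → C(Icc (-h) (0 : ℝ), Y) := fun n => tens 𝕜 Y (peak h n) v with hp
    have hp1 : ∀ n, ‖p n‖ ≤ ‖v‖ := fun n => by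
      refine ((tens 𝕜 Y (peak h n)).le_of_opNorm_le
        ((norm_tens_le _).trans (norm_peak_le n)) v).trans ?_
      simp
    have hp0 : ∀ n, p n (zeroPt h) = v := fun n => by
      simp [hp, tens_apply, peak_zeroPt]
    set q : ℝ → Y := fun θ => if θ < t then S.op ((t : ℝ) - θ).toNNReal v else 0 with hq
    set I : 𝕜 := ∫ θ in (0 : ℝ)..h, g θ (q θ) with hI
    have hlim : Tendsto (fun n => ∫ θ in (0 : ℝ)..h, g θ ((shiftSemigroup h S).op t (p n)
        (projIcc (-h) 0 (neg_h_le h) (-θ)))) atTop (𝓝 I) := by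
      refine intervalIntegral.tendsto_integral_filter_of_dominated_convergence
        (fun θ => ‖g θ‖ * (‖(shiftSemigroup h S).op t‖ * ‖v‖)) (Eventually.of_forall fun n => ?_)
        (Eventually.of_forall fun n => Eventually.of_forall fun θ _ => ?_) ?_
        ?_
      · have := integrableOn_apply H.1 (c := fun θ : ℝ => (shiftSemigroup h S).op t (p n)
          (projIcc (-h) 0 (neg_h_le h) (-θ))) (by fun_prop)
        exact this.def'.aestronglyMeasurable
      · refine ((g θ).le_opNorm _).trans ?_
        gcongr
        refine (ContinuousMap.norm_coe_le_norm _ _).trans ?_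
        refine (ContinuousLinearMap.le_opNorm _ _).trans ?_
        gcongr
        exact hp1 n
      · exact hgi.norm.mul_const _
      · have hne : ∀ᵐ θ : ℝ, θ ≠ (t : ℝ) := by simp [ae_iff]
        filter_upwards [hne] with θ hθt hθ
        rw [uIoc_of_le hh.out.le] at hθ
        have hm : -θ ∈ Icc (-h) (0 : ℝ) := ⟨by linarith [hθ.2], by linarith [hθ.1]⟩
        rw [projIcc_of_mem _ hm]
        simp only [shiftSemigroup_apply]
        rcases lt_or_gt_of_ne hθt with hlt | hgt
        · refine tendsto_const_nhds.congr fun n => ?_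
          rw [shiftExt, if_neg (by linarith), hp0, hq]
          simp only [if_pos hlt]
          rfl
        · refine tendsto_const_nhds.congr' ?_
          have hm2 : (t : ℝ) + -θ ∈ Icc (-h) (0 : ℝ) :=
            ⟨by linarith [hθ.2, t.2], by linarith⟩
          filter_upwards [peak_eventually (h := h) (by linarith : (t : ℝ) + -θ < 0) hm2] with n hn
          have := shiftExt_of_mem S (p n) ⟨_, hm2⟩
          simp only at this
          rw [this, hp]
          simp only [tens_apply, hn]
          simp only [hq, if_neg hgt.not_gt]
          simp
    have hlim2 : Tendsto (fun n => ((shiftSemigroup h S).adjoint t f - f) (p n)) atTop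
        (𝓝 (y (S.op t v) + I - y v)) := by
      have : ∀ n, (shiftSemigroup h S).adjoint t f (p n) = y (S.op t v) +
          ∫ θ in (0 : ℝ)..h, g θ ((shiftSemigroup h S).op t (p n)
            (projIcc (-h) 0 (neg_h_le h) (-θ))) := by
        intro n
        rw [C0Semigroup.adjoint_apply, H.2]
        congr 2
        rw [shiftSemigroup_apply]
        have : (t : ℝ) + (zeroPt h : ℝ) = t := by simp [zeroPt]
        rw [this, shiftExt_coe, hp0]
      exact ((hlim.const_add (y (S.op t v))).congr fun n => (this n).symm).sub (H.tendsto v)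
    have hbd : ‖y (S.op t v) + I - y v‖ ≤ ‖(shiftSemigroup h S).adjoint t f - f‖ * ‖v‖ := by
      refine le_of_tendsto hlim2.norm (Eventually.of_forall fun n => ?_)
      refine (ContinuousLinearMap.le_opNorm _ _).trans ?_
      gcongr
      exact hp1 n
    have hIbd : ‖I‖ ≤ (M * ∫ θ in (0 : ℝ)..h, (if θ < t then ‖g θ‖ else 0)) * ‖v‖ := by
      rw [hI, ← intervalIntegral.integral_const_mul, ← intervalIntegral.integral_mul_const]
      refine intervalIntegral.norm_integral_le_of_norm_le hh.out.le
        (Eventually.of_forall fun θ hθ => ?_) ((hind.const_mul _).mul_const _)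
      simp only [hq]
      split_ifs with hθt
      · refine ((g θ).le_opNorm _).trans ?_
        have : ‖S.op ((t : ℝ) - θ).toNNReal v‖ ≤ M * ‖v‖ := by
          refine (S.op _).le_of_opNorm_le (hM _ ?_) v
          refine le_trans ?_ ht
          rw [Real.toNNReal_le_iff_le_coe]
          linarith [hθ.1]
        calc ‖g θ‖ * _ ≤ ‖g θ‖ * (M * ‖v‖) := by gcongr
          _ = _ := by ring
      · simp
    have e : (S.adjoint t y - y) v = (y (S.op t v) + I - y v) - I := by
      change y (S.op t v) - y v = _
      ring
    rw [e, add_mul]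
    exact (norm_sub_le _ _).trans (add_le_add hbd hIbd)
  refine S.mem_sunDual_of_tendsto ?_
  have hl1 : Tendsto (fun t : ℝ≥0 => ‖(shiftSemigroup h S).adjoint t f - f‖) (𝓝 0) (𝓝 0) := by
    have hc : Continuous fun t : ℝ≥0 => (shiftSemigroup h S).adjoint t f := hf
    have h0 : (shiftSemigroup h S).adjoint 0 f = f := by
      ext φ
      rw [C0Semigroup.adjoint_apply, C0Semigroup.op_zero]
      rfl
    simpa [h0] using ((hc.tendsto 0).sub_const f).norm
  have hl2 : Tendsto (fun t : ℝ≥0 => ∫ θ in (0 : ℝ)..h, (if θ < t then ‖g θ‖ else 0))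
      (𝓝 0) (𝓝 (∫ θ in (0 : ℝ)..h, (0 : ℝ))) := by
    refine intervalIntegral.tendsto_integral_filter_of_dominated_convergence
      (fun θ => ‖g θ‖) (Eventually.of_forall fun t => ?_)
      (Eventually.of_forall fun t => Eventually.of_forall fun θ _ => ?_) hgi.norm
      (Eventually.of_forall fun θ hθ => ?_)
    · exact hgi.def'.aestronglyMeasurable.norm.indicator (s := Iio (t : ℝ)) measurableSet_Iio
    · split_ifs <;> simp
    · rw [uIoc_of_le hh.out.le] at hθ
      refine tendsto_const_nhds.congr' ?_
      filter_upwards [Iio_mem_nhds (show (0 : ℝ≥0) < ⟨θ, hθ.1.le⟩ from hθ.1)] with t ht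
      have : (t : ℝ) < θ := ht
      rw [if_neg (by linarith)]
  have hl3 := hl1.add (hl2.const_mul M)
  simp only [intervalIntegral.integral_zero, mul_zero, add_zero] at hl3
  refine squeeze_zero' (Eventually.of_forall fun _ => norm_nonneg _) ?_ hl3
  filter_upwards [Iic_mem_nhds (show (0 : ℝ≥0) < 1 by simp)] with t ht
  exact key t ht

end SunDual2

section SunDual3

set_option linter.unusedSectionVars false

variable {𝕜 Y : Type*} [RCLike 𝕜] [NormedAddCommGroup Y] [NormedSpace 𝕜 Y] [CompleteSpace Y]
variable {h : ℝ} [hh : Fact (0 < h)]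

/-- Averages of `T₀*(s) f` against a continuous weight `k` supported in `[0,a]` are represented by
pairs `(y, g)` with `g` continuous. -/
theorem exists_rep_average (S : C0Semigroup 𝕜 Y)
    {f : StrongDual 𝕜 C(Icc (-h) (0 : ℝ), Y)} (hf : f ∈ (shiftSemigroup h S).sunDual)
    {a : ℝ} (ha : 0 < a) {k : ℝ → ℝ} (hk : Continuous k) (hk0 : ∀ s, s ≤ 0 → k s = 0)
    (hka : ∀ s, a ≤ s → k s = 0) :
    ∃ (y : StrongDual 𝕜 Y) (g : ℝ → StrongDual 𝕜 Y), Continuous g ∧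
      IsRepresentedBy (∫ s in (0 : ℝ)..a, k s • (shiftSemigroup h S).adjoint s.toNNReal f) y g := by
  let : NormedSpace ℝ Y := NormedSpace.restrictScalars ℝ 𝕜 Y
  have : IsScalarTower ℝ 𝕜 Y := RestrictScalars.isScalarTower ℝ 𝕜 Y
  set T := shiftSemigroup h S with hT
  set f' := ∫ s in (0 : ℝ)..a, k s • T.adjoint s.toNNReal f with hf'
  let K : ℝ → C(Icc (-h) (0 : ℝ), ℝ) := fun r => ⟨fun θ => k (r - θ), by fun_prop⟩
  have hK : Continuous K :=
    (ContinuousMap.curry ⟨fun p : ℝ × Icc (-h) (0 : ℝ) => k (p.1 - p.2), by fun_prop⟩).continuous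
  let g : ℝ → StrongDual 𝕜 Y := fun r => f.comp (tens 𝕜 Y (K (-r)))
  have hg : Continuous g :=
    (continuous_const (y := f)).clm_comp (continuous_tens.comp (hK.comp continuous_neg))
  have hgi : IntegrableOn g (Icc 0 h) := hg.continuousOn.integrableOn_Icc
  have hAdj : Continuous fun t : ℝ≥0 => T.adjoint t f := hf
  have hAdj' : Continuous fun s : ℝ => k s • T.adjoint s.toNNReal f :=
    hk.smul (hAdj.comp continuous_real_toNNReal)
  have happ : Continuous fun p : (Y →L[𝕜] C(Icc (-h) (0 : ℝ), Y)) × Y => p.1 p.2 :=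
    isBoundedBilinearMap_apply.continuous
  have hval : ∀ φ, f' φ = f (∫ s in (0 : ℝ)..a, k s • T.op s.toNNReal φ) := by
    intro φ
    have hc : Continuous fun s : ℝ => k s • T.op s.toNNReal φ :=
      hk.smul ((T.continuous_orbit φ).comp continuous_real_toNNReal)
    have e1 : f' φ = ∫ s in (0 : ℝ)..a, (k s • T.adjoint s.toNNReal f) φ :=
      (((ContinuousLinearMap.apply 𝕜 𝕜 φ).intervalIntegral_comp_comm
        (hAdj'.intervalIntegrable 0 a))).symm
    rw [e1, ← f.intervalIntegral_comp_comm (hc.intervalIntegrable 0 a)]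
    refine intervalIntegral.integral_congr fun s _ => ?_
    rw [← algebraMap_smul 𝕜 (k s) (T.op s.toNNReal φ), map_smul, algebraMap_smul]
    rfl
  let w : Y → C(Icc (-h) (0 : ℝ), Y) := fun v =>
    ∫ r in (0 : ℝ)..a, tens 𝕜 Y (K r) (S.op r.toNNReal v)
  have hdec : ∀ φ : C(Icc (-h) (0 : ℝ), Y), ∫ s in (0 : ℝ)..a, k s • T.op s.toNNReal φ =
      w (φ (zeroPt h)) +
        ∫ r in (0 : ℝ)..h, tens 𝕜 Y (K (-r)) (φ (projIcc (-h) 0 (neg_h_le h) (-r))) := by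
    intro φ
    have hc1 : Continuous fun s : ℝ => k s • T.op s.toNNReal φ :=
      hk.smul ((T.continuous_orbit φ).comp continuous_real_toNNReal)
    have hc2 : Continuous fun r : ℝ => tens 𝕜 Y (K r) (S.op r.toNNReal (φ (zeroPt h))) :=
      happ.comp ((continuous_tens.comp hK).prodMk
        ((S.continuous_orbit _).comp continuous_real_toNNReal))
    have hc3 : Continuous fun r : ℝ =>
        tens 𝕜 Y (K (-r)) (φ (projIcc (-h) 0 (neg_h_le h) (-r))) :=
      happ.comp ((continuous_tens.comp (hK.comp continuous_neg)).prodMk (by fun_prop))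
    ext θ
    have ev : ∀ (c : ℝ → C(Icc (-h) (0 : ℝ), Y)), Continuous c → ∀ b : ℝ,
        (∫ r in (0 : ℝ)..b, c r) θ = ∫ r in (0 : ℝ)..b, c r θ := fun c hc b =>
      ((ContinuousMap.evalCLM ℝ θ).intervalIntegral_comp_comm
        (hc.intervalIntegrable 0 b)).symm
    rw [ContinuousMap.add_apply, ev _ hc1, ev _ hc3, ev _ hc2]
    have hext := continuous_shiftExt S φ
    set G : ℝ → Y := fun r => k (r - θ) • shiftExt S φ r with hG
    have hGc : Continuous G := by fun_prop
    have hGi : ∀ b c : ℝ, IntervalIntegrable G volume b c := fun b c => hGc.intervalIntegrable b c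
    have hθ1 := θ.2.1
    have hθ2 := θ.2.2
    have z1 : ∫ r in (-h)..(θ : ℝ), G r = 0 := by
      rw [intervalIntegral.integral_congr (g := fun _ => (0 : Y))]
      · simp
      · intro r hr
        rw [uIcc_of_le hθ1] at hr
        simp only [hG, hk0 (r - θ) (by linarith [hr.2]), zero_smul]
    have z2 : ∫ r in (a + θ)..a, G r = 0 := by
      rw [intervalIntegral.integral_congr (g := fun _ => (0 : Y))]
      · simp
      · intro r hr
        rw [uIcc_of_le (by linarith)] at hr
        simp only [hG, hka (r - θ) (by linarith [hr.1]), zero_smul]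
    have i1 : ∫ s in (0 : ℝ)..a, (k s • T.op s.toNNReal φ) θ = ∫ r in (θ : ℝ)..(a + θ), G r := by
      have := intervalIntegral.integral_comp_add_right (a := 0) (b := a) G (θ : ℝ)
      rw [zero_add] at this
      rw [← this]
      refine intervalIntegral.integral_congr fun s hs => ?_
      rw [uIcc_of_le ha.le] at hs
      simp only [hG, ContinuousMap.smul_apply, hT, shiftSemigroup_apply, add_sub_cancel_right,
        Real.coe_toNNReal _ hs.1]
    have i2 : ∫ r in (0 : ℝ)..a, tens 𝕜 Y (K r) (S.op r.toNNReal (φ (zeroPt h))) θ =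
        ∫ r in (0 : ℝ)..a, G r := by
      refine intervalIntegral.integral_congr fun r hr => ?_
      rw [uIcc_of_le ha.le] at hr
      have := shiftExt_coe S φ r.toNNReal
      rw [Real.coe_toNNReal _ hr.1] at this
      simp only [hG, tens_apply, K, ContinuousMap.coe_mk, this]
      exact algebraMap_smul 𝕜 _ _
    have i3 : ∫ r in (0 : ℝ)..h,
        tens 𝕜 Y (K (-r)) (φ (projIcc (-h) 0 (neg_h_le h) (-r))) θ = ∫ r in (-h)..(0 : ℝ), G r := by
      have := intervalIntegral.integral_comp_neg (a := 0) (b := h) G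
      rw [neg_zero] at this
      rw [← this]
      refine intervalIntegral.integral_congr fun r hr => ?_
      rw [uIcc_of_le hh.out.le] at hr
      simp only [hG, tens_apply, K, ContinuousMap.coe_mk]
      rw [shiftExt, if_pos (by linarith [hr.1])]
      exact algebraMap_smul 𝕜 _ _
    rw [i1, i2, i3, add_comm (∫ r in (0 : ℝ)..a, G r), intervalIntegral.integral_add_adjacent_intervals (hGi _ _) (hGi _ _),
      ← intervalIntegral.integral_add_adjacent_intervals (hGi (-h) θ) (hGi θ a),
      ← intervalIntegral.integral_add_adjacent_intervals (hGi θ (a + θ)) (hGi (a + θ) a), z1, z2]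
    simp
  have hfin : ∀ φ : C(Icc (-h) (0 : ℝ), Y), f' φ = f (w (φ (zeroPt h))) +
      ∫ r in (0 : ℝ)..h, g r (φ (projIcc (-h) 0 (neg_h_le h) (-r))) := by
    intro φ
    have hc3 : Continuous fun r : ℝ =>
        tens 𝕜 Y (K (-r)) (φ (projIcc (-h) 0 (neg_h_le h) (-r))) :=
      happ.comp ((continuous_tens.comp (hK.comp continuous_neg)).prodMk (by fun_prop))
    rw [hval, hdec, map_add, ← f.intervalIntegral_comp_comm (hc3.intervalIntegrable 0 h)]
    rfl
  refine ⟨f'.comp (tens 𝕜 Y 1) - ∫ r in (0 : ℝ)..h, g r, g, hg, hgi, fun φ => ?_⟩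
  have e1 : f (w (φ (zeroPt h))) = (f'.comp (tens 𝕜 Y 1) - ∫ r in (0 : ℝ)..h, g r)
      (φ (zeroPt h)) := by
    have e2 : (∫ r in (0 : ℝ)..h, g r) (φ (zeroPt h)) = ∫ r in (0 : ℝ)..h, g r (φ (zeroPt h)) :=
      (((ContinuousLinearMap.apply 𝕜 𝕜 (φ (zeroPt h))).intervalIntegral_comp_comm
        (hg.intervalIntegrable 0 h))).symm
    rw [sub_apply, e2, ContinuousLinearMap.comp_apply, hfin]
    simp [tens_apply]
  rw [hfin, e1]

theorem exists_rep_near (S : C0Semigroup 𝕜 Y)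
    {f : StrongDual 𝕜 C(Icc (-h) (0 : ℝ), Y)} (hf : f ∈ (shiftSemigroup h S).sunDual)
    {ε : ℝ} (hε : 0 < ε) :
    ∃ (f' : StrongDual 𝕜 C(Icc (-h) (0 : ℝ), Y)) (y : StrongDual 𝕜 Y) (g : ℝ → StrongDual 𝕜 Y),
      Continuous g ∧ IsRepresentedBy f' y g ∧ ‖f' - f‖ ≤ ε := by
  have hAdj : Continuous fun t : ℝ≥0 => (shiftSemigroup h S).adjoint t f := hf
  have hAdj' : Continuous fun s : ℝ => (shiftSemigroup h S).adjoint s.toNNReal f :=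
    hAdj.comp continuous_real_toNNReal
  have h0 : (shiftSemigroup h S).adjoint 0 f = f := by
    ext φ
    rw [C0Semigroup.adjoint_apply, C0Semigroup.op_zero]
    rfl
  obtain ⟨a, ha, hfa⟩ : ∃ a > 0, ∀ s ∈ Icc (0 : ℝ) a,
      ‖(shiftSemigroup h S).adjoint s.toNNReal f - f‖ ≤ ε := by
    have hlim : Tendsto (fun s : ℝ => ‖(shiftSemigroup h S).adjoint s.toNNReal f - f‖) (𝓝 0)
        (𝓝 0) := by
      simpa [h0] using ((hAdj'.tendsto 0).sub_const f).norm
    obtain ⟨δ, hδ, H⟩ := Metric.eventually_nhds_iff.1 (hlim.eventually_lt_const hε)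
    refine ⟨δ / 2, by positivity, fun s hs => (H ?_).le⟩
    rw [Real.dist_eq, sub_zero, abs_of_nonneg hs.1]
    linarith [hs.2]
  set k0 : ℝ → ℝ := fun s => max (s * (a - s)) 0 with hk0def
  have hk0 : Continuous k0 := by fun_prop
  have hk0n : ∀ s, 0 ≤ k0 s := fun s => le_max_right _ _
  set m := ∫ s in (0 : ℝ)..a, k0 s with hm
  have hmpos : 0 < m := by
    refine intervalIntegral.intervalIntegral_pos_of_pos_on (hk0.intervalIntegrable _ _)
      (fun s hs => ?_) ha
    exact lt_max_of_lt_left (mul_pos hs.1 (by linarith [hs.2]))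
  set k : ℝ → ℝ := fun s => m⁻¹ * k0 s with hkdef
  have hk : Continuous k := by fun_prop
  have hkn : ∀ s, 0 ≤ k s := fun s => mul_nonneg (by positivity) (hk0n s)
  have hk1 : ∫ s in (0 : ℝ)..a, k s = 1 := by
    simp only [hkdef]
    rw [intervalIntegral.integral_const_mul, ← hm, inv_mul_cancel₀ hmpos.ne']
  obtain ⟨y, g, hg, H⟩ := exists_rep_average S hf ha hk
    (fun s hs => by
      simp only [hkdef, hk0def]
      rw [max_eq_right (mul_nonpos_of_nonpos_of_nonneg hs (by linarith)), mul_zero])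
    (fun s hs => by
      simp only [hkdef, hk0def]
      rw [max_eq_right (mul_nonpos_of_nonneg_of_nonpos (by linarith) (by linarith)), mul_zero])
  refine ⟨_, y, g, hg, H, ?_⟩
  have e : (∫ s in (0 : ℝ)..a, k s • (shiftSemigroup h S).adjoint s.toNNReal f) - f =
      ∫ s in (0 : ℝ)..a, k s • ((shiftSemigroup h S).adjoint s.toNNReal f - f) := by
    simp only [smul_sub]
    have c1 : Continuous fun s => k s • (shiftSemigroup h S).adjoint s.toNNReal f := hk.smul hAdj'
    have c2 : Continuous fun s => k s • f := hk.smul continuous_const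
    rw [intervalIntegral.integral_sub (c1.intervalIntegrable _ _)
      (c2.intervalIntegrable _ _), intervalIntegral.integral_smul_const,
      hk1, one_smul]
  rw [e]
  have hb : ∫ s in (0 : ℝ)..a, k s * ε = ε := by
    rw [intervalIntegral.integral_mul_const, hk1, one_mul]
  refine (intervalIntegral.norm_integral_le_of_norm_le ha.le
    (Eventually.of_forall fun s hs => ?_)
    ((hk.mul continuous_const).intervalIntegrable 0 a)).trans hb.le
  rw [norm_smul, Real.norm_of_nonneg (hkn s)]
  exact mul_le_mul_of_nonneg_left (hfa s ⟨hs.1.le, hs.2⟩) (hkn s)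

/-- Every functional in the sun dual `X⊙` of `X = C([-h,0]; Y)` with respect to the shift
semigroup is represented by a pair `(y, g)` with `y ∈ Y⊙` and `g ∈ L¹([0,h], Y*)`. -/
theorem exists_representation (S : C0Semigroup 𝕜 Y) (f : (shiftSemigroup h S).sunDual) :
    ∃ (y : S.sunDual) (g : ℝ → StrongDual 𝕜 Y),
      IsRepresentedBy (f : StrongDual 𝕜 C(Icc (-h) (0 : ℝ), Y)) y g := by
  suffices ∃ (y : StrongDual 𝕜 Y) (g : ℝ → StrongDual 𝕜 Y),
      IsRepresentedBy (f : StrongDual 𝕜 C(Icc (-h) (0 : ℝ), Y)) y g by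
    obtain ⟨y, g, H⟩ := this
    exact ⟨⟨y, H.mem_sunDual f.2⟩, g, H⟩
  obtain ⟨f, hf⟩ := f
  simp only
  have hseq : ∀ n : ℕ, ∃ (f' : StrongDual 𝕜 C(Icc (-h) (0 : ℝ), Y)) (y : StrongDual 𝕜 Y)
      (g : ℝ → StrongDual 𝕜 Y), Continuous g ∧ IsRepresentedBy f' y g ∧
        ‖f' - f‖ ≤ 1 / ((n : ℝ) + 1) :=
    fun n => exists_rep_near S hf (by positivity)
  choose F y g hg H hF using hseq
  have hFlim : Tendsto F atTop (𝓝 f) :=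
    tendsto_iff_norm_sub_tendsto_zero.2 (squeeze_zero (fun _ => norm_nonneg _) hF
      tendsto_one_div_add_atTop_nhds_zero_nat)
  have hFc : CauchySeq F := hFlim.cauchySeq
  have hyc : CauchySeq y := by
    rw [Metric.cauchySeq_iff] at hFc ⊢
    intro ε hε
    obtain ⟨N, hN⟩ := hFc ε hε
    refine ⟨N, fun m hm n hn => lt_of_le_of_lt ?_ (hN m hm n hn)⟩
    rw [dist_eq_norm, dist_eq_norm]
    exact ((H m).sub (H n)).norm_le
  obtain ⟨y₀, hy₀⟩ := cauchySeq_tendsto_of_complete hyc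
  set μ : Measure ℝ := volume.restrict (Icc 0 h) with hμ
  have hgi : ∀ n, Integrable (g n) μ := fun n => (H n).1
  have hGc : CauchySeq fun n => (hgi n).toL1 (g n) := by
    rw [Metric.cauchySeq_iff] at hFc ⊢
    intro ε hε
    obtain ⟨N, hN⟩ := hFc (ε / 2) (by positivity)
    refine ⟨N, fun m hm n hn => ?_⟩
    have h1 := hN m hm n hn
    rw [dist_eq_norm] at h1 ⊢
    rw [← Integrable.toL1_sub, L1.norm_of_fun_eq_integral_norm]
    have h2 := ((H m).sub (H n)).integral_norm_le ((hg m).sub (hg n))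
    rw [intervalIntegral.integral_of_le hh.out.le, ← integral_Icc_eq_integral_Ioc] at h2
    have h3 : ∫ x, ‖(g m - g n) x‖ ∂μ ≤ 2 * ‖F m - F n‖ := h2
    linarith
  obtain ⟨G, hG⟩ := cauchySeq_tendsto_of_complete hGc
  refine ⟨y₀, G, L1.integrable_coeFn G, fun φ => ?_⟩
  have hcφ : Continuous fun θ : ℝ => φ (projIcc (-h) 0 (neg_h_le h) (-θ)) := by fun_prop
  have hlim1 : Tendsto (fun n => F n φ) atTop (𝓝 (f φ)) :=
    ((ContinuousLinearMap.apply 𝕜 𝕜 φ).continuous.tendsto f).comp hFlim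
  have hlim2 : Tendsto (fun n => y n (φ (zeroPt h))) atTop (𝓝 (y₀ (φ (zeroPt h)))) :=
    ((ContinuousLinearMap.apply 𝕜 𝕜 (φ (zeroPt h))).continuous.tendsto y₀).comp hy₀
  have hlim3 : Tendsto
      (fun n => ∫ θ in (0 : ℝ)..h, g n θ (φ (projIcc (-h) 0 (neg_h_le h) (-θ)))) atTop
      (𝓝 (∫ θ in (0 : ℝ)..h, G θ (φ (projIcc (-h) 0 (neg_h_le h) (-θ))))) := by
    rw [tendsto_iff_norm_sub_tendsto_zero] at hG ⊢
    have hG' := hG.mul_const ‖φ‖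
    rw [zero_mul] at hG'
    refine squeeze_zero (fun _ => norm_nonneg _) (fun n => ?_) hG'
    rw [← intervalIntegral.integral_sub (integrableOn_apply (hgi n) hcφ)
      (integrableOn_apply (L1.integrable_coeFn G) hcφ), L1.norm_eq_integral_norm]
    rw [← integral_mul_const, intervalIntegral.integral_of_le hh.out.le,
      ← integral_Icc_eq_integral_Ioc]
    refine norm_integral_le_of_norm_le ((L1.integrable_coeFn _).norm.mul_const _) ?_
    filter_upwards [Lp.coeFn_sub ((hgi n).toL1 (g n)) G, (hgi n).coeFn_toL1] with θ h1 h2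
    rw [h1, Pi.sub_apply, h2, ← sub_apply]
    exact ((g n θ - G θ).le_opNorm _).trans (by gcongr; exact φ.norm_coe_le_norm _)
  refine tendsto_nhds_unique hlim1 ?_
  exact (hlim2.add hlim3).congr fun n => ((H n).2 φ).symm

/-- The operator `δ : X⊙ → Y⊙`, `δ f = y` for `f ∈ X⊙` represented by the pair `(y, g)`. -/
def delta (S : C0Semigroup 𝕜 Y) : (shiftSemigroup h S).sunDual →L[𝕜] S.sunDual :=
  LinearMap.mkContinuous
    { toFun := fun f => (exists_representation S f).choose
      map_add' := fun f f' => by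
        obtain ⟨g, H⟩ := (exists_representation S f).choose_spec
        obtain ⟨g', H'⟩ := (exists_representation S f').choose_spec
        obtain ⟨g'', H''⟩ := (exists_representation S (f + f')).choose_spec
        exact Subtype.ext (H''.unique (H.add H'))
      map_smul' := fun c f => by
        obtain ⟨g, H⟩ := (exists_representation S f).choose_spec
        obtain ⟨g', H'⟩ := (exists_representation S (c • f)).choose_spec
        exact Subtype.ext (H'.unique (H.smul c)) } 1 (fun f => by
    obtain ⟨g, H⟩ := (exists_representation S f).choose_spec
    rw [one_mul]
    exact H.norm_le)

theorem delta_eq (S : C0Semigroup 𝕜 Y) {f : (shiftSemigroup h S).sunDual} {y : S.sunDual}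
    {g : ℝ → StrongDual 𝕜 Y}
    (H : IsRepresentedBy (f : StrongDual 𝕜 C(Icc (-h) (0 : ℝ), Y)) y g) : delta S f = y := by
  obtain ⟨g', H'⟩ := (exists_representation S f).choose_spec
  exact Subtype.ext (H'.unique H)

/-- The operator `ℓ = δ* ∘ j_Y : Y → X⊙*`, where `δ*` is the adjoint of `δ`. -/
def ell (h : ℝ) [hh : Fact (0 < h)] (S : C0Semigroup 𝕜 Y) :
    Y →L[𝕜] StrongDual 𝕜 (shiftSemigroup h S).sunDual :=
  (ContinuousLinearMap.precomp 𝕜 (delta S)).comp S.sunEmbedding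

theorem ell_apply (S : C0Semigroup 𝕜 Y) (v : Y) (f : (shiftSemigroup h S).sunDual) :
    ell h S v f = (delta S f : StrongDual 𝕜 Y) v := rfl

end SunDual3

end

end AbstractDDE

open AbstractDDE

/-!
The abstract integral equation is an equation in `X = C([-h,0]; Y)` in disguise. For a continuous
`w : [0,∞) → Y` let `r ↦ ∫₀ʳ S(r - τ) w(τ) dτ` be the Duhamel integral, extended by zero to `r ≤ 0`,
and let `ψ t ∈ X` be its history at time `t`. The heart of the proof is that the weak* integral
`∫₀ᵗ T₀⊙*(t - τ) ℓ w(τ) dτ` exists and equals `j (ψ t)` (`hasWeakStarIntegral_ell`).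

To see this, let `pₙ` be the peak functions at `0`. The representation of `X⊙` gives
`⟨v, δ f⟩ = lim f (pₙ ⊗ v)` (`tendsto_delta`), so by dominated convergence the weak* integral,
tested against `f`, is the limit of `f (∫₀ᵗ T₀(t - τ) (pₙ ⊗ w(τ)) dτ)`. The integral inside is an
ordinary integral in `X`, and it converges to `ψ t` in norm: evaluated at `θ` it is the Duhamel
integral at `t + θ`, up to an error of at most `sup ‖w‖ · ∫₀ᵗ max (1 - n s) 0 ds`, uniformly in `θ`
(`tendsto_integral_peak`). In this way no explicit representation of `T₀⊙(s) f` is needed.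

Moreover `j` is injective (`C0Semigroup.sunEmbedding_injective`): for every `f` in the dual space,
the averages `v ↦ f (∫₀ᵃ T(s) v ds)` lie in the sun dual, so `j v = 0` makes all `∫₀ᵃ T(s) v ds`
vanish, and with them their derivative `v` at `a = 0`. Hence `u` solves the abstract integral
equation if and only if `u` is continuous and `u(t) = T₀(t) φ + ψ t`, where `w = F ∘ u`
(`isAIESolution_ell_iff`). This identity says that `u(t)` is the history at time `t` of the function
`x` given by `x(r) = φ(r)` for `r ≤ 0` and by the variation-of-constants formula for `r ≥ 0`.
-/

namespace AbstractDDE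

noncomputable section

/-! ### Strongly continuous semigroups and their sun duals -/

namespace C0Semigroup

variable {𝕜 E : Type*} [RCLike 𝕜] [NormedAddCommGroup E] [NormedSpace 𝕜 E]

/-- A `C₀`-semigroup on a Banach space is jointly continuous, because it is strongly continuous and
locally bounded in norm. -/
theorem continuous_uncurry_op [CompleteSpace E] (T : C0Semigroup 𝕜 E) :
    Continuous fun p : ℝ≥0 × E => T.op p.1 p.2 := by
  rw [continuous_iff_continuousAt]
  rintro ⟨t₀, v₀⟩
  obtain ⟨M, hM0, hM⟩ := T.exists_norm_op_le (t₀ + 1)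
  rw [ContinuousAt, tendsto_iff_norm_sub_tendsto_zero]
  have hlim : Tendsto (fun p : ℝ≥0 × E => M * ‖p.2 - v₀‖ + ‖T.op p.1 v₀ - T.op t₀ v₀‖)
      (𝓝 (t₀, v₀)) (𝓝 0) := by
    have hc : Continuous fun p : ℝ≥0 × E => M * ‖p.2 - v₀‖ + ‖T.op p.1 v₀ - T.op t₀ v₀‖ := by
      have := (T.continuous_orbit v₀).comp (continuous_fst (X := ℝ≥0) (Y := E))
      simp only [Function.comp_def] at this
      fun_prop
    simpa using hc.tendsto (t₀, v₀)
  refine squeeze_zero' (Eventually.of_forall fun _ => norm_nonneg _) ?_ hlim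
  filter_upwards [continuous_fst.continuousAt.preimage_mem_nhds
    (Iic_mem_nhds (show (t₀, v₀).1 < t₀ + 1 by simp))] with p hp
  calc ‖T.op p.1 p.2 - T.op t₀ v₀‖
      = ‖T.op p.1 (p.2 - v₀) + (T.op p.1 v₀ - T.op t₀ v₀)‖ := by rw [map_sub]; congr 1; abel
    _ ≤ ‖T.op p.1 (p.2 - v₀)‖ + ‖T.op p.1 v₀ - T.op t₀ v₀‖ := norm_add_le _ _
    _ ≤ _ := by gcongr; exact (T.op p.1).le_of_opNorm_le (hM _ hp) _

theorem continuous_orbit_toNNReal (T : C0Semigroup 𝕜 E) (v : E) :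
    Continuous fun s : ℝ => T.op s.toNNReal v :=
  (T.continuous_orbit v).comp continuous_real_toNNReal

variable [NormedSpace ℝ E] [CompleteSpace E]

theorem exists_norm_integral_orbit_le (T : C0Semigroup 𝕜 E) (a : ℝ≥0) :
    ∃ M : ℝ, 0 ≤ M ∧ ∀ b c : ℝ≥0, b ≤ a → c ≤ a → ∀ v : E,
      ‖∫ s in (b : ℝ)..c, T.op s.toNNReal v‖ ≤ M * ‖v‖ * |(c : ℝ) - b| := by
  obtain ⟨M, hM0, hM⟩ := T.exists_norm_op_le a
  refine ⟨M, hM0, fun b c hb hc v => ?_⟩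
  refine intervalIntegral.norm_integral_le_of_norm_le_const fun s hs => ?_
  refine (T.op _).le_of_opNorm_le (hM _ ?_) v
  rw [Real.toNNReal_le_iff_le_coe]
  exact hs.2.trans (max_le hb hc)

variable [IsScalarTower ℝ 𝕜 E]

/-- The operator `v ↦ ∫₀ᵃ T(s) v ds`. -/
def orbitIntegral (T : C0Semigroup 𝕜 E) (a : ℝ≥0) : E →L[𝕜] E :=
  LinearMap.mkContinuousOfExistsBound
    { toFun := fun v => ∫ s in (0 : ℝ)..a, T.op s.toNNReal v
      map_add' := fun v w => by
        simp only [map_add]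
        exact intervalIntegral.integral_add ((T.continuous_orbit_toNNReal v).intervalIntegrable _ _)
          ((T.continuous_orbit_toNNReal w).intervalIntegrable _ _)
      map_smul' := fun c v => by
        simp only [map_smul, RingHom.id_apply]
        exact intervalIntegral.integral_smul c _ } (by
    obtain ⟨M, -, hM⟩ := T.exists_norm_integral_orbit_le a
    refine ⟨M * a, fun v => ?_⟩
    have := hM 0 a zero_le le_rfl v
    rw [NNReal.coe_zero, sub_zero, abs_of_nonneg a.coe_nonneg] at this
    exact this.trans_eq (by ring))

theorem orbitIntegral_apply (T : C0Semigroup 𝕜 E) (a : ℝ≥0) (v : E) :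
    T.orbitIntegral a v = ∫ s in (0 : ℝ)..a, T.op s.toNNReal v := rfl

theorem orbitIntegral_op_sub (T : C0Semigroup 𝕜 E) (a t : ℝ≥0) (v : E) :
    T.orbitIntegral a (T.op t v) - T.orbitIntegral a v =
      (∫ s in (t : ℝ)..(0 : ℝ≥0), T.op s.toNNReal v) -
        ∫ s in ((a + t : ℝ≥0) : ℝ)..a, T.op s.toNNReal v := by
  have hi : ∀ b c : ℝ, IntervalIntegrable (fun s : ℝ => T.op s.toNNReal v) volume b c :=
    (T.continuous_orbit_toNNReal v).intervalIntegrable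
  have h1 : T.orbitIntegral a (T.op t v) =
      ∫ s in (t : ℝ)..((a + t : ℝ≥0) : ℝ), T.op s.toNNReal v := by
    have h2 := intervalIntegral.integral_comp_add_right (a := 0) (b := (a : ℝ))
      (fun s : ℝ => T.op s.toNNReal v) (t : ℝ)
    rw [zero_add] at h2
    rw [orbitIntegral_apply, NNReal.coe_add, ← h2]
    refine intervalIntegral.integral_congr fun s hs => ?_
    rw [uIcc_of_le a.coe_nonneg] at hs
    rw [Real.toNNReal_add hs.1 t.coe_nonneg, Real.toNNReal_coe, T.op_add]
    rfl
  rw [h1, orbitIntegral_apply, NNReal.coe_zero,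
    intervalIntegral.integral_interval_sub_interval_comm (hi _ _) (hi _ _) (hi _ _)]

/-- Averaging over the orbits maps the whole dual space into the sun dual. -/
theorem comp_orbitIntegral_mem_sunDual (T : C0Semigroup 𝕜 E) (f : StrongDual 𝕜 E) (a : ℝ≥0) :
    f.comp (T.orbitIntegral a) ∈ T.sunDual := by
  obtain ⟨M, hM0, hM⟩ := T.exists_norm_integral_orbit_le (a + 1)
  refine T.mem_sunDual_of_tendsto ?_
  have hlim : Tendsto (fun t : ℝ≥0 => ‖f‖ * (2 * M * (t : ℝ))) (𝓝 0) (𝓝 0) := by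
    have hc : Continuous fun t : ℝ≥0 => ‖f‖ * (2 * M * (t : ℝ)) := by fun_prop
    simpa using hc.tendsto 0
  refine squeeze_zero' (Eventually.of_forall fun _ => norm_nonneg _) ?_ hlim
  filter_upwards [Iic_mem_nhds (show (0 : ℝ≥0) < 1 by simp)] with t ht
  have ht1 : t ≤ a + 1 := le_add_left ht
  have ht2 : a + t ≤ a + 1 := by gcongr; exact ht
  refine ContinuousLinearMap.opNorm_le_bound _ (by positivity) fun v => ?_
  have e : (T.adjoint t (f.comp (T.orbitIntegral a)) - f.comp (T.orbitIntegral a)) v =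
      f (T.orbitIntegral a (T.op t v) - T.orbitIntegral a v) := by
    rw [map_sub]; rfl
  rw [e, mul_assoc]
  refine (f.le_opNorm _).trans (mul_le_mul_of_nonneg_left ?_ (norm_nonneg f))
  rw [orbitIntegral_op_sub]
  have b1 := hM t 0 ht1 zero_le v
  have b2 := hM (a + t) a ht2 (by simp) v
  have a1 : |((0 : ℝ≥0) : ℝ) - t| = t := by simp
  have a2 : |(a : ℝ) - (a + t : ℝ≥0)| = t := by simp
  rw [a1] at b1
  rw [a2] at b2
  exact (norm_sub_le _ _).trans ((add_le_add b1 b2).trans_eq (by ring))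

theorem sunEmbedding_injective (T : C0Semigroup 𝕜 E) : Function.Injective T.sunEmbedding := by
  rw [injective_iff_map_eq_zero]
  intro v hv
  have hzero : ∀ a : ℝ≥0, T.orbitIntegral a v = 0 := fun a =>
    SeparatingDual.eq_zero_of_forall_dual_eq_zero (R := 𝕜) fun f =>
      congrArg (fun z : StrongDual 𝕜 T.sunDual => z ⟨_, T.comp_orbitIntegral_mem_sunDual f a⟩) hv
  -- The right derivative at `0` of `a ↦ ∫₀ᵃ T(s) v ds = 0` is `T(0) v = v`.
  have hd := ((T.continuous_orbit_toNNReal v).integral_hasStrictDerivAt 0 0).hasDerivAt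
  have h0 : HasDerivWithinAt (fun a : ℝ => ∫ s in (0 : ℝ)..a, T.op s.toNNReal v) 0 (Ici 0) 0 :=
    (hasDerivWithinAt_const (0 : ℝ) (Ici 0) (0 : E)).congr (fun a ha => hzero ⟨a, ha⟩)
      (hzero 0)
  have h1 := (uniqueDiffWithinAt_Ici (0 : ℝ)).eq_deriv _ hd.hasDerivWithinAt h0
  simpa [T.op_zero] using h1

end C0Semigroup

theorem HasWeakStarIntegral.unique {𝕜 W : Type*} [RCLike 𝕜] [NormedAddCommGroup W]
    [NormedSpace 𝕜 W] {f : ℝ → StrongDual 𝕜 W} {a b : ℝ} {z z' : StrongDual 𝕜 W}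
    (H : HasWeakStarIntegral f a b z) (H' : HasWeakStarIntegral f a b z') : z = z' := by
  ext w
  rw [(H w).2, (H' w).2]

section Duhamel

variable {𝕜 Y : Type*} [RCLike 𝕜] [NormedAddCommGroup Y] [NormedSpace 𝕜 Y]
variable {h : ℝ}

/-! ### The operator `δ` as a limit along peak functions -/

theorem norm_tens_peak_apply_le [Fact (0 < h)] (n : ℕ) (v : Y) : ‖tens 𝕜 Y (peak h n) v‖ ≤ ‖v‖ := by
  simpa using (tens 𝕜 Y (peak h n)).le_of_opNorm_le ((norm_tens_le _).trans (norm_peak_le n)) v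

theorem shiftExt_tens_peak [Fact (0 < h)] (S : C0Semigroup 𝕜 Y) (n : ℕ) (v : Y) (r : ℝ≥0) :
    shiftExt S (tens 𝕜 Y (peak h n) v) r = S.op r v := by
  rw [shiftExt_coe, tens_apply, peak_zeroPt, RCLike.ofReal_one, one_smul]

theorem norm_shiftExt_tens_peak [Fact (0 < h)] (S : C0Semigroup 𝕜 Y) (n : ℕ) (v : Y) {r : ℝ}
    (hr : r ∈ Icc (-h) (0 : ℝ)) :
    ‖shiftExt S (tens 𝕜 Y (peak h n) v) r‖ = max (1 + n * r) 0 * ‖v‖ := by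
  rw [shiftExt_of_mem S _ ⟨r, hr⟩, tens_apply, norm_smul, RCLike.norm_ofReal,
    abs_of_nonneg (le_max_right _ _)]
  rfl

theorem exists_norm_le_of_le (w : C(ℝ≥0, Y)) (t : ℝ≥0) : ∃ C : ℝ, ∀ τ ≤ t, ‖w τ‖ ≤ C := by
  obtain ⟨C, hC⟩ := isCompact_Icc.exists_bound_of_continuousOn (s := Icc (0 : ℝ≥0) t)
    w.continuous.continuousOn
  exact ⟨C, fun τ hτ => hC τ ⟨zero_le, hτ⟩⟩

theorem tendsto_integral_max_one_sub_mul (b : ℝ) (hb : 0 ≤ b) :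
    Tendsto (fun n : ℕ => ∫ s in (0 : ℝ)..b, max (1 - n * s) 0) atTop (𝓝 0) := by
  have hlim : Tendsto (fun n : ℕ => ∫ s in (0 : ℝ)..b, max (1 - n * s) 0) atTop
      (𝓝 (∫ s in (0 : ℝ)..b, (0 : ℝ))) := by
    refine intervalIntegral.tendsto_integral_filter_of_dominated_convergence (fun _ => 1)
      (Eventually.of_forall fun n => ?_)
      (Eventually.of_forall fun n => Eventually.of_forall fun s hs => ?_) (by simp)
      (Eventually.of_forall fun s hs => ?_)
    · exact (by fun_prop : Continuous fun s : ℝ => max (1 - n * s) 0).aestronglyMeasurable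
    · rw [uIoc_of_le hb] at hs
      have : 0 ≤ (n : ℝ) * s := mul_nonneg n.cast_nonneg hs.1.le
      rw [Real.norm_of_nonneg (le_max_right _ _)]
      exact max_le (by linarith) zero_le_one
    · rw [uIoc_of_le hb] at hs
      refine tendsto_const_nhds.congr' ?_
      obtain ⟨N, hN⟩ := exists_nat_gt (1 / s)
      filter_upwards [eventually_ge_atTop N] with n hn
      have h1 : 1 / s < n := hN.trans_le (by exact_mod_cast hn)
      rw [div_lt_iff₀ hs.1] at h1
      exact (max_eq_right (by linarith)).symm
  simpa using hlim

/-- The integral term of a representation of `f` vanishes along the peaks `pₙ ⊗ v`, so that only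
the value of `δ f` at `v` remains. -/
theorem tendsto_delta [CompleteSpace Y] [Fact (0 < h)] (S : C0Semigroup 𝕜 Y)
    (f : (shiftSemigroup h S).sunDual) (v : Y) :
    Tendsto (fun n => (f : StrongDual 𝕜 C(Icc (-h) (0 : ℝ), Y)) (tens 𝕜 Y (peak h n) v)) atTop
      (𝓝 ((delta S f : StrongDual 𝕜 Y) v)) := by
  obtain ⟨y, g, H⟩ := exists_representation S f
  rw [delta_eq S H]
  exact H.tendsto v

theorem continuous_op_tens_peak [CompleteSpace Y] [Fact (0 < h)] (S : C0Semigroup 𝕜 Y)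
    (w : C(ℝ≥0, Y)) (t : ℝ≥0) (n : ℕ) :
    Continuous fun τ : ℝ => (shiftSemigroup h S).op (t - τ.toNNReal)
      (tens 𝕜 Y (peak h n) (w τ.toNNReal)) :=
  (shiftSemigroup h S).continuous_uncurry_op.comp (f := fun τ : ℝ =>
    (t - τ.toNNReal, tens 𝕜 Y (peak h n) (w τ.toNNReal))) (by fun_prop)

/-! ### The Duhamel integral -/

variable [NormedSpace ℝ Y]

/-- The Duhamel integral `∫₀ʳ S(r - τ) w(τ) dτ`. -/
def duhamel (S : C0Semigroup 𝕜 Y) (w : ℝ≥0 → Y) (r : ℝ≥0) : Y :=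
  ∫ τ in (0 : ℝ)..r, S.op (r - τ.toNNReal) (w τ.toNNReal)

@[simp]
theorem duhamel_zero (S : C0Semigroup 𝕜 Y) (w : ℝ≥0 → Y) : duhamel S w 0 = 0 := by
  simp [duhamel]

variable [CompleteSpace Y]

theorem continuous_duhamel (S : C0Semigroup 𝕜 Y) {w : ℝ≥0 → Y} (hw : Continuous w) :
    Continuous (duhamel S w) := by
  refine intervalIntegral.continuous_parametric_intervalIntegral_of_continuous
    (f := fun (r : ℝ≥0) (τ : ℝ) => S.op (r - τ.toNNReal) (w τ.toNNReal)) ?_ NNReal.continuous_coe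
  exact S.continuous_uncurry_op.comp (f := fun p : ℝ≥0 × ℝ =>
    (p.1 - p.2.toNNReal, w p.2.toNNReal)) (by fun_prop)

/-- The history at time `t` of the Duhamel integral, extended by zero to negative times. -/
def duhamelHistory (h : ℝ) (S : C0Semigroup 𝕜 Y) (w : C(ℝ≥0, Y)) (t : ℝ≥0) :
    C(Icc (-h) (0 : ℝ), Y) :=
  ⟨fun θ => duhamel S w (t + θ : ℝ).toNNReal, (continuous_duhamel S w.continuous).comp
    (by fun_prop)⟩

theorem duhamelHistory_apply (S : C0Semigroup 𝕜 Y) (w : C(ℝ≥0, Y)) (t : ℝ≥0)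
    (θ : Icc (-h) (0 : ℝ)) :
    duhamelHistory h S w t θ = duhamel S w (t + θ : ℝ).toNNReal := rfl

variable [hh : Fact (0 < h)]

/-- With `r = (t + θ)⁺`, the integrand at `θ` is that of the Duhamel integral for `τ < r`, whereas
for `τ > r` the shift has not moved the peak as far as `θ` yet and only its left tail is seen. -/
theorem norm_integral_peak_sub_le (S : C0Semigroup 𝕜 Y) (w : C(ℝ≥0, Y)) (t : ℝ≥0) {C : ℝ}
    (hC : ∀ τ ≤ t, ‖w τ‖ ≤ C) (n : ℕ) :
    ‖(∫ τ in (0 : ℝ)..t, (shiftSemigroup h S).op (t - τ.toNNReal)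
        (tens 𝕜 Y (peak h n) (w τ.toNNReal))) - duhamelHistory h S w t‖ ≤
      (∫ s in (0 : ℝ)..t, max (1 - n * s) 0) * C := by
  have hC0 : 0 ≤ C := (norm_nonneg _).trans (hC 0 zero_le)
  have hmax : Continuous fun s : ℝ => max (1 - n * s) 0 := by fun_prop
  refine (ContinuousMap.norm_le _ (mul_nonneg (intervalIntegral.integral_nonneg t.2
    fun s _ => le_max_right _ _) hC0)).2 fun θ => ?_
  have hk := continuous_op_tens_peak (h := h) S w t n
  set k : ℝ → Y := fun τ =>
    shiftExt S (tens 𝕜 Y (peak h n) (w τ.toNNReal)) ((t - τ.toNNReal : ℝ≥0) + θ) with hkdef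
  have hkc : Continuous k := (ContinuousMap.evalCLM ℝ θ).continuous.comp hk
  have hki : ∀ b c : ℝ, IntervalIntegrable k volume b c := hkc.intervalIntegrable
  have ev : (∫ τ in (0 : ℝ)..t, (shiftSemigroup h S).op (t - τ.toNNReal)
        (tens 𝕜 Y (peak h n) (w τ.toNNReal))) θ = ∫ τ in (0 : ℝ)..t, k τ :=
    ((ContinuousMap.evalCLM ℝ θ).intervalIntegral_comp_comm (hk.intervalIntegrable 0 t)).symm
  set r : ℝ≥0 := (t + θ : ℝ).toNNReal with hr
  have hθ := θ.2.2
  have hrt : (r : ℝ) ≤ t := by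
    rw [hr, Real.coe_toNNReal']
    exact max_le (by linarith) t.2
  have hrθ : (t : ℝ) + θ ≤ r := Real.le_coe_toNNReal _
  have e1 : ∫ τ in (0 : ℝ)..r, k τ = duhamel S w r := by
    -- The open interval matters: it is empty if `t + θ ≤ 0`.
    refine intervalIntegral.integral_congr_uIoo fun τ hτ => ?_
    rw [uIoo_of_le r.coe_nonneg] at hτ
    have hrpos : 0 < (t : ℝ) + θ := Real.toNNReal_pos.1 (NNReal.coe_pos.1 (hτ.1.trans hτ.2))
    have hre : (r : ℝ) = t + θ := Real.coe_toNNReal _ hrpos.le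
    have hτ1 : (τ.toNNReal : ℝ) = τ := Real.coe_toNNReal _ hτ.1.le
    have hle : τ.toNNReal ≤ r := Real.toNNReal_le_iff_le_coe.2 hτ.2.le
    have hle' : τ.toNNReal ≤ t := hle.trans hrt
    have e : ((t - τ.toNNReal : ℝ≥0) : ℝ) + θ = (r - τ.toNNReal : ℝ≥0) := by
      rw [NNReal.coe_sub hle, NNReal.coe_sub hle', hre]; ring
    simp only [hkdef]
    rw [e, shiftExt_tens_peak]
  have e2 : (∫ τ in (0 : ℝ)..t, k τ) - duhamel S w r = ∫ τ in (r : ℝ)..t, k τ := by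
    rw [← e1, ← intervalIntegral.integral_add_adjacent_intervals (hki 0 r) (hki r t),
      add_sub_cancel_left]
  rw [ContinuousMap.sub_apply, ev, duhamelHistory_apply, ← hr, e2]
  have b1 : ‖∫ τ in (r : ℝ)..t, k τ‖ ≤ ∫ τ in (r : ℝ)..t, max (1 - n * (τ - r)) 0 * C := by
    refine intervalIntegral.norm_integral_le_of_norm_le hrt
      (Eventually.of_forall fun τ hτ => ?_)
      ((by fun_prop : Continuous fun τ : ℝ => max (1 - n * (τ - r)) 0 * C).intervalIntegrable _ _)
    have hτ0 : 0 ≤ τ := r.2.trans hτ.1.le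
    have hτ1 : (τ.toNNReal : ℝ) = τ := Real.coe_toNNReal _ hτ0
    have hτt : τ.toNNReal ≤ t := Real.toNNReal_le_iff_le_coe.2 hτ.2
    have e : ((t - τ.toNNReal : ℝ≥0) : ℝ) = t - τ := by rw [NNReal.coe_sub hτt, hτ1]
    have hm : ((t - τ.toNNReal : ℝ≥0) : ℝ) + θ ∈ Icc (-h) (0 : ℝ) := by
      rw [e]
      exact ⟨by linarith [θ.2.1, hτ.2], by linarith [hτ.1]⟩
    simp only [hkdef]
    rw [norm_shiftExt_tens_peak S n _ hm, e]
    have hn : (n : ℝ) * (t - τ + θ) ≤ n * -(τ - r) :=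
      mul_le_mul_of_nonneg_left (by linarith) n.cast_nonneg
    gcongr
    · linarith
    · exact hC _ hτt
  have b2 : ∫ τ in (r : ℝ)..t, max (1 - n * (τ - r)) 0 ≤
      ∫ s in (0 : ℝ)..t, max (1 - n * s) 0 := by
    rw [intervalIntegral.integral_comp_sub_right (fun s : ℝ => max (1 - n * s) 0) (r : ℝ),
      sub_self]
    exact intervalIntegral.integral_mono_interval le_rfl (by linarith)
      (by linarith [r.2]) (Eventually.of_forall fun s => le_max_right _ _)
      (hmax.intervalIntegrable _ _)
  refine b1.trans ?_
  rw [intervalIntegral.integral_mul_const]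
  exact mul_le_mul_of_nonneg_right b2 hC0

theorem tendsto_integral_peak (S : C0Semigroup 𝕜 Y) (w : C(ℝ≥0, Y)) (t : ℝ≥0) :
    Tendsto (fun n : ℕ => ∫ τ in (0 : ℝ)..t, (shiftSemigroup h S).op (t - τ.toNNReal)
      (tens 𝕜 Y (peak h n) (w τ.toNNReal))) atTop (𝓝 (duhamelHistory h S w t)) := by
  obtain ⟨C, hC⟩ := exists_norm_le_of_le w t
  rw [tendsto_iff_norm_sub_tendsto_zero]
  have hlim := (tendsto_integral_max_one_sub_mul t t.2).mul_const C
  rw [zero_mul] at hlim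
  exact squeeze_zero (fun _ => norm_nonneg _) (norm_integral_peak_sub_le S w t hC) hlim

/-! ### The weak* integral -/

/-- The weak* convolution integral of `T₀⊙*` with `ℓ ∘ w` takes values in the range of `j`, and
`j⁻¹` of it is the history of the Duhamel integral of `w`. -/
theorem hasWeakStarIntegral_ell (S : C0Semigroup 𝕜 Y) (w : C(ℝ≥0, Y)) (t : ℝ≥0) :
    HasWeakStarIntegral (fun τ : ℝ => (shiftSemigroup h S).sunStar (t - τ.toNNReal)
      (ell h S (w τ.toNNReal))) 0 t
      ((shiftSemigroup h S).sunEmbedding (duhamelHistory h S w t)) := by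
  set T := shiftSemigroup h S
  intro f
  set k : ℕ → ℝ → C(Icc (-h) (0 : ℝ), Y) := fun n τ =>
    T.op (t - τ.toNNReal) (tens 𝕜 Y (peak h n) (w τ.toNNReal))
  have hkc : ∀ n, Continuous (k n) := continuous_op_tens_peak S w t
  set p : ℕ → ℝ → 𝕜 := fun n τ => (f : StrongDual 𝕜 C(Icc (-h) (0 : ℝ), Y)) (k n τ)
  have hpc : ∀ n, Continuous (p n) := fun n =>
    (f : StrongDual 𝕜 C(Icc (-h) (0 : ℝ), Y)).continuous.comp (hkc n)
  set q : ℝ → 𝕜 := fun τ => T.sunStar (t - τ.toNNReal) (ell h S (w τ.toNNReal)) f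
  have hpq : ∀ τ, Tendsto (fun n => p n τ) atTop (𝓝 (q τ)) := fun τ =>
    tendsto_delta S (T.sun.op (t - τ.toNNReal) f) (w τ.toNNReal)
  obtain ⟨M, hM0, hM⟩ := T.exists_norm_op_le t
  obtain ⟨C, hC⟩ := exists_norm_le_of_le w t
  set K : ℝ := ‖(f : StrongDual 𝕜 C(Icc (-h) (0 : ℝ), Y))‖ * (M * C)
  have hpb : ∀ n, ∀ τ ∈ uIoc (0 : ℝ) t, ‖p n τ‖ ≤ K := by
    intro n τ hτ
    rw [uIoc_of_le t.coe_nonneg] at hτ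
    refine (ContinuousLinearMap.le_opNorm _ _).trans (mul_le_mul_of_nonneg_left ?_ (norm_nonneg _))
    refine ((T.op _).le_of_opNorm_le (hM _ tsub_le_self) _).trans
      (mul_le_mul_of_nonneg_left ?_ hM0)
    exact (norm_tens_peak_apply_le n _).trans (hC _ (Real.toNNReal_le_iff_le_coe.2 hτ.2))
  -- Measurability of the integrand `q` is inherited from its continuous approximations `p n`.
  have hqi : IntervalIntegrable q volume 0 t := by
    rw [intervalIntegrable_iff]
    refine Integrable.mono' (g := fun _ => K) (by simp)
      (aestronglyMeasurable_of_tendsto_ae atTop (fun n => (hpc n).aestronglyMeasurable)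
        (Eventually.of_forall hpq)) ?_
    filter_upwards [ae_restrict_mem measurableSet_uIoc] with τ hτ
    exact le_of_tendsto (hpq τ).norm (Eventually.of_forall fun n => hpb n τ hτ)
  refine ⟨hqi, tendsto_nhds_unique (f := fun n : ℕ => ∫ τ in (0 : ℝ)..t, p n τ) (l := atTop) ?_ ?_⟩
  · have hlim := ((f : StrongDual 𝕜 C(Icc (-h) (0 : ℝ), Y)).continuous.tendsto _).comp
      (tendsto_integral_peak (h := h) S w t)
    exact hlim.congr fun n => ((f : StrongDual 𝕜 C(Icc (-h) (0 : ℝ), Y)).intervalIntegral_comp_comm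
      ((hkc n).intervalIntegrable 0 t)).symm
  · exact intervalIntegral.tendsto_integral_filter_of_dominated_convergence (fun _ => K)
      (Eventually.of_forall fun n => (hpc n).aestronglyMeasurable)
      (Eventually.of_forall fun n => Eventually.of_forall (hpb n)) (by simp)
      (Eventually.of_forall fun τ _ => hpq τ)

variable [IsScalarTower ℝ 𝕜 Y]

/-- The abstract integral equation with `G = ℓ ∘ F`, pulled back to `X` along `j`. -/
theorem isAIESolution_ell_iff (S : C0Semigroup 𝕜 Y) {F : C(Icc (-h) (0 : ℝ), Y) → Y}
    (φ : C(Icc (-h) (0 : ℝ), Y)) {u : ℝ≥0 → C(Icc (-h) (0 : ℝ), Y)} (hu : Continuous u)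
    (hFu : Continuous fun t => F (u t)) :
    IsAIESolution (shiftSemigroup h S) (ell h S ∘ F) φ u ↔
      ∀ t, u t = (shiftSemigroup h S).op t φ + duhamelHistory h S ⟨fun t => F (u t), hFu⟩ t := by
  have hint := hasWeakStarIntegral_ell (h := h) S ⟨fun t => F (u t), hFu⟩
  refine ⟨fun H t => ?_, fun H => ⟨hu, fun t => ⟨_, hint t, H t⟩⟩⟩
  obtain ⟨ψ, hψ, hut⟩ := H.2 t
  rw [hut, (shiftSemigroup h S).sunEmbedding_injective (hψ.unique (hint t))]

end Duhamel

/-! ### Histories and mild solutions -/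

section History

variable {𝕜 Y : Type*} [RCLike 𝕜] [NormedAddCommGroup Y] [NormedSpace 𝕜 Y]
variable {h : ℝ}

theorem continuous_history (x : C(Ici (-h), Y)) : Continuous (history x) := by
  have hc : Continuous fun p : ℝ≥0 × Icc (-h) (0 : ℝ) =>
      x ⟨p.1 + p.2, by have := p.2.2.1; have := p.1.2; simp only [mem_Ici]; linarith⟩ :=
    x.continuous.comp (by fun_prop)
  exact (ContinuousMap.curry ⟨_, hc⟩).continuous

theorem history_zero_apply (x : C(Ici (-h), Y)) (θ : Icc (-h) (0 : ℝ)) :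
    history x 0 θ = x ⟨θ, θ.2.1⟩ :=
  congrArg x (Subtype.ext (by simp))

variable [hh : Fact (0 < h)]

theorem history_zeroPt (x : C(Ici (-h), Y)) (t : ℝ≥0) :
    history x t (zeroPt h) = x ⟨t, (neg_h_le h).trans t.2⟩ :=
  congrArg x (Subtype.ext (by simp [zeroPt]))

theorem history_injective :
    Function.Injective fun (x : C(Ici (-h), Y)) (t : ℝ≥0) => history x t := by
  intro x x' hx
  ext ⟨r, hr⟩
  rcases le_total r 0 with h0 | h0
  · have := congrArg (fun ψ => ψ ⟨r, hr, h0⟩) (congrFun hx 0)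
    simpa only [history_zero_apply] using this
  · exact (history_zeroPt x ⟨r, h0⟩).symm.trans
      ((congrArg (fun ψ => ψ (zeroPt h)) (congrFun hx ⟨r, h0⟩)).trans (history_zeroPt x' ⟨r, h0⟩))

variable [CompleteSpace Y] [NormedSpace ℝ Y]

/-- A function is a mild solution if and only if its histories satisfy the integral equation in
`X`. -/
theorem isMildSolution_iff (S : C0Semigroup 𝕜 Y) {F : C(Icc (-h) (0 : ℝ), Y) → Y}
    (φ : C(Icc (-h) (0 : ℝ), Y)) (x : C(Ici (-h), Y)) (hFx : Continuous fun t => F (history x t)) :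
    IsMildSolution S F φ x ↔
      ∀ t, history x t =
        (shiftSemigroup h S).op t φ + duhamelHistory h S ⟨fun t => F (history x t), hFx⟩ t := by
  constructor
  · rintro ⟨h0, hx⟩ t
    ext θ
    rw [ContinuousMap.add_apply, shiftSemigroup_apply, duhamelHistory_apply]
    rcases le_total ((t : ℝ) + θ) 0 with hs | hs
    · have hm : (t : ℝ) + θ ∈ Icc (-h) (0 : ℝ) := ⟨by linarith [θ.2.1, t.2], hs⟩
      rw [Real.toNNReal_of_nonpos hs, duhamel_zero, add_zero, shiftExt_of_mem S φ ⟨_, hm⟩, ← h0,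
        history_zero_apply]
      rfl
    · have hr := shiftExt_coe S φ (t + θ : ℝ).toNNReal
      have hxr := hx (t + θ : ℝ).toNNReal
      simp only [Real.coe_toNNReal _ hs] at hr hxr
      rw [hr]
      refine hxr.trans ?_
      simp only [duhamel, Real.coe_toNNReal _ hs, ContinuousMap.coe_mk]
  · intro H
    refine ⟨?_, fun t => ?_⟩
    · ext θ
      have hθ : ((0 : ℝ≥0) + θ : ℝ) = θ := by simp
      rw [H 0, ContinuousMap.add_apply, (shiftSemigroup h S).op_zero, duhamelHistory_apply, hθ,
        Real.toNNReal_of_nonpos θ.2.2, duhamel_zero, add_zero]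
      rfl
    · have hθ : (t + zeroPt h : ℝ) = t := by simp [zeroPt]
      rw [← history_zeroPt, H t, ContinuousMap.add_apply, shiftSemigroup_apply,
        duhamelHistory_apply, hθ, shiftExt_coe, Real.toNNReal_coe]
      rfl

theorem exists_history_eq (S : C0Semigroup 𝕜 Y) (φ : C(Icc (-h) (0 : ℝ), Y)) (w : C(ℝ≥0, Y)) :
    ∃ x : C(Ici (-h), Y), ∀ t,
      history x t = (shiftSemigroup h S).op t φ + duhamelHistory h S w t :=
  ⟨⟨fun r => shiftExt S φ r + duhamel S w (r : ℝ).toNNReal,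
    ((continuous_shiftExt S φ).comp continuous_subtype_val).add
      ((continuous_duhamel S w.continuous).comp
        (continuous_real_toNNReal.comp continuous_subtype_val))⟩, fun _ => rfl⟩

variable [IsScalarTower ℝ 𝕜 Y]

theorem isAIESolution_history_iff (S : C0Semigroup 𝕜 Y) {F : C(Icc (-h) (0 : ℝ), Y) → Y}
    (hF : Continuous F) (φ : C(Icc (-h) (0 : ℝ), Y)) (x : C(Ici (-h), Y)) :
    IsAIESolution (shiftSemigroup h S) (ell h S ∘ F) φ (fun t => history x t) ↔
      IsMildSolution S F φ x := by
  have hc := continuous_history x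
  rw [isAIESolution_ell_iff S φ hc (hF.comp hc), isMildSolution_iff S φ x (hF.comp hc)]

theorem IsAIESolution.exists_history_eq {S : C0Semigroup 𝕜 Y} {F : C(Icc (-h) (0 : ℝ), Y) → Y}
    (hF : Continuous F) {φ : C(Icc (-h) (0 : ℝ), Y)} {u : ℝ≥0 → C(Icc (-h) (0 : ℝ), Y)}
    (hu : IsAIESolution (shiftSemigroup h S) (ell h S ∘ F) φ u) :
    ∃ x : C(Ici (-h), Y), (fun t => history x t) = u := by
  have hFu := hF.comp hu.1
  obtain ⟨x, hx⟩ := AbstractDDE.exists_history_eq S φ ⟨fun t => F (u t), hFu⟩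
  exact ⟨x, funext fun t => (hx t).trans (((isAIESolution_ell_iff S φ hu.1 hFu).1 hu t).symm)⟩

end History

end

end AbstractDDE

open AbstractDDE
theorem mainTheorem2 {𝕜 Y : Type*} [RCLike 𝕜] [NormedAddCommGroup Y] [NormedSpace 𝕜 Y]
    [NormedSpace ℝ Y] [IsScalarTower ℝ 𝕜 Y] [CompleteSpace Y] (h : ℝ) [Fact (0 < h)]
    (S : C0Semigroup 𝕜 Y) (B : Y →ₗ.[𝕜] Y) (hB : S.IsGenerator B)
    (F : C(Icc (-h) (0 : ℝ), Y) → Y) (hF : Continuous F) (φ : C(Icc (-h) (0 : ℝ), Y)) :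
    (∀ x : C(Ici (-h), Y), IsMildSolution S F φ x →
      IsAIESolution (shiftSemigroup h S) (ell h S ∘ F) φ (fun t => history x t)) ∧
    (∀ u : ℝ≥0 → C(Icc (-h) (0 : ℝ), Y),
      IsAIESolution (shiftSemigroup h S) (ell h S ∘ F) φ u →
        ∃ x : C(Ici (-h), Y),
          (∀ θ : Icc (-h) (0 : ℝ), x ⟨θ, θ.2.1⟩ = φ θ) ∧
          (∀ t : ℝ≥0, x ⟨t, (neg_h_le h).trans t.2⟩ = u t (zeroPt h)) ∧
          IsMildSolution S F φ x) ∧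
    BijOn (fun (x : C(Ici (-h), Y)) (t : ℝ≥0) => history x t)
      {x | IsMildSolution S F φ x}
      {u | IsAIESolution (shiftSemigroup h S) (ell h S ∘ F) φ u} := by
  have hmaps : ∀ x : C(Ici (-h), Y), IsMildSolution S F φ x →
      IsAIESolution (shiftSemigroup h S) (ell h S ∘ F) φ (fun t => history x t) :=
    fun x hx => (isAIESolution_history_iff S hF φ x).2 hx
  refine ⟨hmaps, fun u hu => ?_, hmaps, history_injective.injOn, fun u hu => ?_⟩
  · obtain ⟨x, rfl⟩ := hu.exists_history_eq hF
    have hx := (isAIESolution_history_iff S hF φ x).1 hu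
    exact ⟨x, fun θ => by rw [← history_zero_apply, hx.1], fun t => (history_zeroPt x t).symm, hx⟩
  · obtain ⟨x, rfl⟩ := IsAIESolution.exists_history_eq hF hu
    exact ⟨x, (isAIESolution_history_iff S hF φ x).1 hu, rfl⟩
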